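/- Let $\mathcal O$ be a complete discrete valuation ring with residue field of characteristic $p>0$ (not assumed algebraically closed), let $H$ be a normal subgroup of a finite group $G$, put $\bar G=G/H$ and $\bar g=gH$ for $g\in G$. Let $b$ be a $G$-invariant block of $\mathcal OH$ (a primitive idempotent of $Z(\mathcal OH)$ fixed by $G$-conjugation). Then $A=\mathcal OGb$ is a $\bar G$-graded $\mathcal O$-algebra, its component $A_x$ consisting of the elements of $A$ supported on the coset $x\in\bar G$; its identity component is $B=\mathcal OHb$, on which $G$ acts by conjugation. Let $P$ be a $p$-subgroup of $G$ and let $P_\gamma$ be a local pointed group on $B$: $\gamma$ is a $(B^P)^\times$-conjugacy class of primitive idempotents of the fixed-point algebra $B^P$, not contained in the kernel $\sum_{Q<P}\mathrm{Tr}_Q^P(B^Q)+J(\mathcal O)B^P$ of the Brauer homomorphism. Let $i\in\gamma$. Consider the following groups. * $E_G^{\bar G}(P_\gamma)=N_G(P_\gamma)/C_H(P)$, where $N_G(P_\gamma)=\{g\in N_G(P)\mid g\gamma g^{-1}=\gamma\}$. * $N_{\mathrm{hU}(iAi)}(Pi)/C_{(iBi)^\times}(Pi)$, where $\mathrm{hU}(iAi)=\bigcup_{x\in\bar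 G}\big((iAi)^\times\cap iA_xi\big)$ is the group of homogeneous units of the algebra $iAi$ (with identity $i$) and $Pi=\{ui\mid u\in P\}$. * $F_A^{\bar G}(P_\gamma)$, the group of all pairs $(\varphi,\bar g)\in\mathrm{Aut}(P)\times\bar G$ such that $\overline{\varphi(u)}=\bar g\,\bar u\,\bar g^{-1}$ for all $u\in P$ and $Ai\simeq (Ai)(\bar g^{-1})_\varphi$ as $\bar G$-graded $(A,\mathcal OP)$-bimodules. Here $Ai$ has $x$-component $A_xi$, and $(Ai)(\bar g^{-1})_\varphi$ is the left $A$-module $Ai$ with right action $m\cdot u=m\varphi(u)$ for $u\in P$ and with $x$-component $A_{x\bar g^{-1}}i$. Then there are group isomorphisms $$E_G^{\bar G}(P_\gamma)\;\xrightarrow{\ \sim\ }\;N_{\mathrm{hU}(iAi)}(Pi)/C_{(iBi)^\times}(Pi)\;\xrightarrow{\ \sim\ }\;F_A^{\bar G}(P_\gamma).$$ The first one sends the class of $g\in N_G(P_\gamma)$ to the class of $ia^{-1}g$, for any $a\in(B^P)^\times$ with $gig^{-1}=aia^{-1}$. The second one sends the class of $n$ to the pair $(\varphi_n,\bar g)$,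 where $\bar g$ is the degree of $n$ and $\varphi_n(u)i=n(ui)n^{-1}$ for $u\in P$. The composite sends the class of $g$ to $(c_g,\bar g)$, where $c_g(u)=gug^{-1}$; so the $(G,\bar G)$-fusions of $P_\gamma$ coincide with the $(A,\bar G)$-fusions. -/

import Mathlib

noncomputable section

namespace GradedFusion

/-! ### Primitive idempotents and corner algebras -/

/-- `e` is a primitive idempotent of the ring `R`: a nonzero idempotent which is not the sum of two
nonzero orthogonal idempotents of `R`. -/
def IsPrimitiveIdempotent {R : Type*} [Ring R] (e : R) : Prop :=
  IsIdempotentElem e ∧ e ≠ 0 ∧ ∀ c d : R, IsIdempotentElem c → IsIdempotentElem d →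
    c * d = 0 → d * c = 0 → c + d = e → c = 0 ∨ d = 0

section Corner

variable {O A : Type*} [CommRing O] [Ring A] [Algebra O A] {e : A}

/-- The `O`-module structure on the corner ring `eAe` (the ring structure, with identity `e`,
is Mathlib's). -/
instance cornerModule (he : IsIdempotentElem e) : Module O he.Corner where
  smul r c := ⟨r • c.1, by
    obtain ⟨a, ha⟩ := c.2
    exact ⟨r • a, by simp [← ha]⟩⟩
  one_smul c := Subtype.ext (one_smul O c.1)
  mul_smul r s c := Subtype.ext (mul_smul r s c.1)
  smul_zero r := Subtype.ext (smul_zero r)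
  smul_add r c d := Subtype.ext (smul_add r c.1 d.1)
  add_smul r s c := Subtype.ext (add_smul r s c.1)
  zero_smul c := Subtype.ext (zero_smul O c.1)

/-- The corner `eAe` of an `O`-algebra as an `O`-algebra with identity `e`. -/
instance cornerAlgebra (he : IsIdempotentElem e) : Algebra O he.Corner :=
  Algebra.ofModule (fun r c d => Subtype.ext (smul_mul_assoc r c.1 d.1))
    (fun r c d => Subtype.ext (mul_smul_comm r c.1 d.1))

/-- The inclusion of `eAe` into `A`, as an `O`-linear map. -/
def cornerIncl (O : Type*) [CommRing O] [Algebra O A] (he : IsIdempotentElem e) :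
    he.Corner →ₗ[O] A where
  toFun c := c.1
  map_add' _ _ := rfl
  map_smul' _ _ := rfl

/-- The map `a ↦ e a e` from `A` onto `eAe`. -/
def cornerProj (O : Type*) [CommRing O] [Algebra O A] (he : IsIdempotentElem e) :
    A →ₗ[O] he.Corner where
  toFun a := ⟨e * a * e, a, rfl⟩
  map_add' a b := Subtype.ext (by
    change e * (a + b) * e = e * a * e + e * b * e
    rw [mul_add, add_mul])
  map_smul' r a := Subtype.ext (by
    change e * (r • a) * e = r • (e * a * e)
    simp)

theorem corner_mul_left (he : IsIdempotentElem e) (c : he.Corner) : e * c.1 = c.1 :=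
  ((Subsemigroup.mem_corner_iff he).mp c.2).1

theorem corner_mul_right (he : IsIdempotentElem e) (c : he.Corner) : c.1 * e = c.1 :=
  ((Subsemigroup.mem_corner_iff he).mp c.2).2

end Corner

/-! ### Group graded algebras -/

/-- A grading of the `O`-algebra `A` by the group `Γ`. -/
structure GroupGrading (O Γ A : Type*) [CommRing O] [Group Γ] [Ring A] [Algebra O A] where
  /-- The homogeneous components. -/
  comp : Γ → Submodule O A
  one_mem : (1 : A) ∈ comp 1
  mul_mem : ∀ {x y : Γ} {a c : A}, a ∈ comp x → c ∈ comp y → a * c ∈ comp (x * y)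
  indep : iSupIndep comp
  iSup_eq_top : ⨆ x, comp x = ⊤

namespace GroupGrading

variable {O Γ A : Type*} [CommRing O] [Group Γ] [Ring A] [Algebra O A]

/-- `A` is the (internal) direct sum of its homogeneous components. -/
theorem isInternal [DecidableEq Γ] (S : GroupGrading O Γ A) : DirectSum.IsInternal S.comp :=
  (DirectSum.isInternal_submodule_iff_iSupIndep_and_iSup_eq_top _).2 ⟨S.indep, S.iSup_eq_top⟩

/-- The inverse of a homogeneous unit of degree `x` is homogeneous of degree `x⁻¹`. -/
theorem inv_mem (S : GroupGrading O Γ A) {x : Γ} (u : Aˣ) (hu : (u : A) ∈ S.comp x) :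
    ((u⁻¹ : Aˣ) : A) ∈ S.comp x⁻¹ := by
  have htop : S.comp x⁻¹ ⊔ ⨆ (y) (_ : y ≠ x⁻¹), S.comp y = ⊤ := by
    rw [eq_top_iff, ← S.iSup_eq_top]
    refine iSup_le fun y => ?_
    by_cases hy : y = x⁻¹
    · subst hy; exact le_sup_left
    · exact le_trans (le_iSup₂_of_le y hy le_rfl) le_sup_right
  obtain ⟨v, hv, w, hw, hvw⟩ := Submodule.mem_sup.1
    (show ((u⁻¹ : Aˣ) : A) ∈ S.comp x⁻¹ ⊔ ⨆ (y) (_ : y ≠ x⁻¹), S.comp y from htop ▸ trivial)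
  have huw : (u : A) * w ∈ ⨆ (y) (_ : y ≠ (1 : Γ)), S.comp y := by
    have hle : (⨆ (y) (_ : y ≠ x⁻¹), S.comp y) ≤
        (⨆ (y) (_ : y ≠ (1 : Γ)), S.comp y).comap (LinearMap.mulLeft O (u : A)) := by
      refine iSup₂_le fun y hy a ha => ?_
      have hxy : x * y ≠ 1 := fun h => hy (eq_inv_of_mul_eq_one_right h)
      exact (le_iSup₂_of_le (f := fun (y : Γ) (_ : y ≠ 1) => S.comp y) (x * y) hxy le_rfl)
        (S.mul_mem hu ha)
    exact hle hw
  have huv : (u : A) * v ∈ S.comp 1 := by simpa using S.mul_mem hu hv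
  have hsum : (u : A) * v + u * w = 1 := by rw [← mul_add, hvw, Units.mul_inv]
  have huw' : (u : A) * w ∈ S.comp 1 := by
    rw [eq_sub_of_add_eq' hsum]; exact Submodule.sub_mem _ S.one_mem huv
  have h0 : (u : A) * w = 0 :=
    Submodule.disjoint_def.1 (S.indep 1) _ huw' huw
  have hw0 : w = 0 := by simpa using h0
  rw [← hvw, hw0, add_zero]; exact hv

/-- The group `hU(A)` of homogeneous units of a graded algebra. -/
def hU (S : GroupGrading O Γ A) : Subgroup Aˣ where
  carrier := {u | ∃ x, (u : A) ∈ S.comp x}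
  one_mem' := ⟨1, S.one_mem⟩
  mul_mem' := by
    rintro u v ⟨x, hx⟩ ⟨y, hy⟩
    exact ⟨x * y, by simpa using S.mul_mem hx hy⟩
  inv_mem' := by
    rintro u ⟨x, hx⟩
    exact ⟨x⁻¹, S.inv_mem u hx⟩

/-- The unit group of the identity component `A₁`, inside the unit group of `A`. -/
def oneUnits (S : GroupGrading O Γ A) : Subgroup Aˣ where
  carrier := {u | (u : A) ∈ S.comp 1 ∧ ((u⁻¹ : Aˣ) : A) ∈ S.comp 1}
  one_mem' := ⟨S.one_mem, by simpa using S.one_mem⟩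
  mul_mem' := by
    rintro u v ⟨h1, h2⟩ ⟨h3, h4⟩
    exact ⟨by simpa using S.mul_mem h1 h3, by simpa using S.mul_mem h4 h2⟩
  inv_mem' := by
    rintro u ⟨h1, h2⟩
    exact ⟨h2, by simpa using h1⟩

/-- The grading of the corner `eAe`, where `e` is an idempotent of the identity component: the
`x`-component is `eAe ∩ A_x = e A_x e`. -/
def corner (S : GroupGrading O Γ A) {e : A} (he : IsIdempotentElem e) (he1 : e ∈ S.comp 1) :
    GroupGrading O Γ he.Corner where
  comp x := (S.comp x).comap (cornerIncl O he)
  one_mem := he1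
  mul_mem ha hc := S.mul_mem ha hc
  indep := by
    intro x
    rw [Submodule.disjoint_def]
    intro c hc hc'
    have hle : (⨆ (y) (_ : y ≠ x), (S.comp y).comap (cornerIncl O he)) ≤
        (⨆ (y) (_ : y ≠ x), S.comp y).comap (cornerIncl O he) :=
      iSup₂_le fun y hy => Submodule.comap_mono (le_iSup₂_of_le y hy le_rfl)
    exact Subtype.ext (Submodule.disjoint_def.1 (S.indep x) c.1 hc (hle hc'))
  iSup_eq_top := by
    rw [eq_top_iff]
    intro c _
    have hle : (⨆ x, S.comp x) ≤
        (⨆ x, (S.comp x).comap (cornerIncl O he)).comap (cornerProj O he) := by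
      refine iSup_le fun x a ha => ?_
      refine (le_iSup (fun x => (S.comp x).comap (cornerIncl O he)) x) ?_
      change e * a * e ∈ S.comp x
      simpa using S.mul_mem (S.mul_mem he1 ha) he1
    have h : cornerProj O he c.1 ∈ ⨆ x, (S.comp x).comap (cornerIncl O he) :=
      hle (S.iSup_eq_top ▸ trivial)
    have hc : cornerProj O he c.1 = c := Subtype.ext (by
      change e * c.1 * e = c.1
      rw [corner_mul_left, corner_mul_right])
    rwa [hc] at h

end GroupGrading

/-! ### `Ḡ`-graded `G`-interior algebras -/

/-- A `Ḡ`-graded `G`-interior `O`-algebra, where `Ḡ = G/H`: a `Ḡ`-graded algebra with a group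
homomorphism `σ` from `G` to its units such that `σ g` is homogeneous of degree `gH`. -/
structure InteriorAlgebra (O : Type*) {G : Type*} (A : Type*) [CommRing O] [Group G]
    (H : Subgroup G) [H.Normal] [Ring A] [Algebra O A] extends GroupGrading O (G ⧸ H) A where
  /-- The structural map. -/
  σ : G →* A
  σ_mem : ∀ g : G, σ g ∈ comp (g : G ⧸ H)

/-- The group `Aut^Ḡ(P)` of pairs `(φ, ḡ)` with `φ ∈ Aut(P)` and `ḡ ∈ Ḡ = G/H`, such that the image
of `φ u` in `Ḡ` is the `ḡ`-conjugate of the image of `u`, for all `u ∈ P`. -/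
def autBar {G : Type*} [Group G] (H : Subgroup G) [H.Normal] (P : Subgroup G) :
    Subgroup (MulAut P × (G ⧸ H)) where
  carrier := {α | ∀ u : P, (((α.1 u : P) : G) : G ⧸ H) = α.2 * ((u : G) : G ⧸ H) * α.2⁻¹}
  one_mem' := by intro u; simp
  mul_mem' := by
    intro α β hα hβ u
    have h1 := hα (β.1 u)
    rw [hβ u] at h1
    simp only [Prod.fst_mul, Prod.snd_mul, MulAut.mul_apply, mul_inv_rev, h1, mul_assoc]
  inv_mem' := by
    intro α hα u
    have h := hα (α.1⁻¹ u)
    rw [MulAut.apply_inv_self] at h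
    simp only [Prod.fst_inv, Prod.snd_inv, h]
    group

/-- The subgroup `C_H(P)`. -/
def centralizerIn {G : Type*} [Group G] (H P : Subgroup G) : Subgroup G :=
  H ⊓ Subgroup.centralizer (P : Set G)

namespace InteriorAlgebra

variable {O G A : Type*} [CommRing O] [Group G] {H : Subgroup G} [H.Normal] [Ring A] [Algebra O A]
variable (S : InteriorAlgebra O A H)

/-- The conjugation action of `G` on `A`. -/
def conj (g : G) (a : A) : A := S.σ g * a * S.σ g⁻¹

theorem conj_one (a : A) : S.conj 1 a = a := by simp [conj]

theorem conj_mul (g h : G) (a : A) : S.conj (g * h) a = S.conj g (S.conj h a) := by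
  simp [conj, mul_assoc]

theorem σ_mul_inv (g : G) : S.σ g * S.σ g⁻¹ = 1 := by rw [← map_mul]; simp

theorem σ_inv_mul (g : G) : S.σ g⁻¹ * S.σ g = 1 := by rw [← map_mul]; simp

/-- The algebra `B^P` of `P`-fixed elements of the identity component `B = A₁`. -/
def fixed (P : Subgroup G) : Subalgebra O A where
  carrier := {a | a ∈ S.comp 1 ∧ ∀ u ∈ P, S.conj u a = a}
  mul_mem' := by
    rintro a c ⟨ha, ha'⟩ ⟨hc, hc'⟩
    refine ⟨by simpa using S.mul_mem ha hc, fun u hu => ?_⟩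
    conv_rhs => rw [← ha' u hu, ← hc' u hu]
    simp only [conj, mul_assoc]
    rw [← mul_assoc (S.σ u⁻¹) (S.σ u), σ_inv_mul, one_mul]
  add_mem' := by
    rintro a c ⟨ha, ha'⟩ ⟨hc, hc'⟩
    refine ⟨Submodule.add_mem _ ha hc, fun u hu => ?_⟩
    conv_rhs => rw [← ha' u hu, ← hc' u hu]
    simp only [conj, mul_add, add_mul]
  algebraMap_mem' r := by
    refine ⟨?_, fun u _ => ?_⟩
    · rw [Algebra.algebraMap_eq_smul_one]
      exact Submodule.smul_mem _ _ S.one_mem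
    · rw [conj, ← Algebra.commutes, mul_assoc, σ_mul_inv, mul_one]

theorem fixed_comm {P : Subgroup G} (i : S.fixed P) {u : G} (hu : u ∈ P) :
    S.σ u * (i : A) = i * S.σ u := by
  have h := i.2.2 u hu
  conv_rhs => rw [← h]
  rw [conj, mul_assoc _ (S.σ u⁻¹), σ_inv_mul, mul_one]

/-! #### Points, the Brauer quotient, local points -/

/-- The relative trace `Tr_Q^P(a) = ∑_{u ∈ [P/Q]} ᵘa` (used for `Q ≤ P` and `a` fixed by `Q`,
so that it does not depend on the choice of coset representatives). -/
def relTrace (Q P : Subgroup G) (a : A) : A :=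
  ∑ᶠ x : P ⧸ Q.subgroupOf P, S.conj ((Quotient.out x : P) : G) a

/-- The kernel `∑_{Q < P} Tr_Q^P(B^Q) + J(O) B^P` of the Brauer homomorphism `Br_P` on `B^P`. -/
def brauerKernel [IsLocalRing O] (P : Subgroup G) : Submodule O A :=
  Submodule.span O {t | ∃ Q : Subgroup G, Q < P ∧ ∃ a ∈ S.fixed Q, t = S.relTrace Q P a} ⊔
    IsLocalRing.maximalIdeal O • Subalgebra.toSubmodule (S.fixed P)

/-- `γ` is a point of `B^P`, i.e. a `(B^P)ˣ`-conjugacy class of primitive idempotents of `B^P`. -/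
def IsPoint (P : Subgroup G) (γ : Set (S.fixed P)) : Prop :=
  ∃ e : S.fixed P, IsPrimitiveIdempotent e ∧
    γ = {j | ∃ a : (S.fixed P)ˣ, j = (a : S.fixed P) * e * ((a⁻¹ : (S.fixed P)ˣ) : S.fixed P)}

/-- `P_γ` is a local pointed group on `B`: `γ` is a point of `B^P` and `Br_P(γ) ≠ 0`. -/
def IsLocalPoint [IsLocalRing O] (P : Subgroup G) (γ : Set (S.fixed P)) : Prop :=
  S.IsPoint P γ ∧ ∃ j ∈ γ, (j : A) ∉ S.brauerKernel P

variable {S} in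
theorem IsPoint.isIdempotentElem {P : Subgroup G} {γ : Set (S.fixed P)} (hγ : S.IsPoint P γ)
    {i : S.fixed P} (hi : i ∈ γ) : IsIdempotentElem (i : A) := by
  obtain ⟨e, he, rfl⟩ := hγ
  obtain ⟨a, rfl⟩ := hi
  have h : IsIdempotentElem ((a : S.fixed P) * e * ((a⁻¹ : (S.fixed P)ˣ) : S.fixed P)) := by
    have h1 := he.1.eq
    simp only [IsIdempotentElem, mul_assoc, Units.inv_mul_cancel_left]
    rw [← mul_assoc e e, h1]
  exact congrArg Subtype.val h.eq

/-! #### `(G, Ḡ)`-fusions -/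

/-- The normalizer `N_G(P_γ)`: the `g ∈ N_G(P)` with `ᵍγ = γ`. -/
def pointNormalizer (P : Subgroup G) (γ : Set (S.fixed P)) : Subgroup G where
  carrier := {g | g ∈ Subgroup.normalizer (P : Set G) ∧
    S.conj g '' (Subtype.val '' γ) = Subtype.val '' γ}
  one_mem' := ⟨one_mem _, by
    rw [show S.conj 1 = id from funext S.conj_one, Set.image_id]⟩
  mul_mem' := by
    rintro g h ⟨hg, hg'⟩ ⟨hh, hh'⟩
    refine ⟨mul_mem hg hh, ?_⟩
    rw [show S.conj (g * h) = S.conj g ∘ S.conj h from funext (S.conj_mul g h), Set.image_comp,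
      hh', hg']
  inv_mem' := by
    rintro g ⟨hg, hg'⟩
    refine ⟨inv_mem hg, ?_⟩
    conv_lhs => rw [← hg']
    rw [← Set.image_comp, show S.conj g⁻¹ ∘ S.conj g = id from funext fun a => by
      simp [← conj_mul, conj_one], Set.image_id]

variable {S} in
/-- `C_H(P)` is contained in `N_G(P_γ)`. -/
theorem centralizerIn_le {P : Subgroup G} {γ : Set (S.fixed P)} (hγ : S.IsPoint P γ) :
    centralizerIn H P ≤ S.pointNormalizer P γ := by
  obtain ⟨e, -, rfl⟩ := hγ
  have key : ∀ h ∈ centralizerIn H P, S.σ h ∈ S.fixed P := by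
    rintro h ⟨hH, hC⟩
    refine ⟨by simpa [(QuotientGroup.eq_one_iff h).2 hH] using S.σ_mem h, fun u hu => ?_⟩
    rw [conj, ← map_mul, ← map_mul, Subgroup.mem_centralizer_iff.1 hC u hu, mul_inv_cancel_right]
  have sub : ∀ h ∈ centralizerIn H P, ∀ j ∈ Subtype.val '' {j | ∃ a : (S.fixed P)ˣ,
      j = (a : S.fixed P) * e * ((a⁻¹ : (S.fixed P)ˣ) : S.fixed P)},
      S.conj h j ∈ Subtype.val '' {j | ∃ a : (S.fixed P)ˣ,
        j = (a : S.fixed P) * e * ((a⁻¹ : (S.fixed P)ˣ) : S.fixed P)} := by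
    rintro h hh _ ⟨_, ⟨a, rfl⟩, rfl⟩
    let w : (S.fixed P)ˣ :=
      ⟨⟨S.σ h, key h hh⟩, ⟨S.σ h⁻¹, key _ (inv_mem hh)⟩, Subtype.ext (S.σ_mul_inv h),
        Subtype.ext (S.σ_inv_mul h)⟩
    refine ⟨_, ⟨w * a, rfl⟩, ?_⟩
    rw [mul_inv_rev, Units.val_mul, Units.val_mul]
    change S.σ h * (a : S.fixed P).1 * e.1 * ((a⁻¹ : (S.fixed P)ˣ).1.1 * S.σ h⁻¹) =
      S.σ h * ((a : S.fixed P).1 * e.1 * (a⁻¹ : (S.fixed P)ˣ).1.1) * S.σ h⁻¹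
    simp only [mul_assoc]
  intro h hh
  refine ⟨Subgroup.centralizer_le_normalizer _ hh.2, Set.Subset.antisymm ?_ ?_⟩
  · rintro _ ⟨j, hj, rfl⟩
    exact sub h hh j hj
  · intro j hj
    exact ⟨S.conj h⁻¹ j, sub _ (inv_mem hh) j hj, by rw [← conj_mul, mul_inv_cancel, conj_one]⟩

/-- `C_H(P)` as a (normal) subgroup of `N_G(P_γ)`. -/
def pointCentralizer (P : Subgroup G) (γ : Set (S.fixed P)) : Subgroup (S.pointNormalizer P γ) :=
  (centralizerIn H P).subgroupOf (S.pointNormalizer P γ)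

instance pointCentralizer_normal (P : Subgroup G) (γ : Set (S.fixed P)) :
    (S.pointCentralizer P γ).Normal := by
  constructor
  rintro ⟨c, hc⟩ hcm ⟨g, hg⟩
  have hcm' : c ∈ H ∧ c ∈ Subgroup.centralizer (P : Set G) := hcm
  change g * c * g⁻¹ ∈ H ∧ g * c * g⁻¹ ∈ Subgroup.centralizer (P : Set G)
  refine ⟨‹H.Normal›.conj_mem c hcm'.1 g, ?_⟩
  rw [Subgroup.mem_centralizer_iff]
  intro u hu
  have hg1 : g⁻¹ ∈ Subgroup.normalizer (P : Set G) := inv_mem hg.1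
  have hu' : g⁻¹ * u * g ∈ (P : Set G) := by
    simpa using (Subgroup.mem_normalizer_iff.1 hg1 u).1 hu
  have h := Subgroup.mem_centralizer_iff.1 hcm'.2 _ hu'
  calc u * (g * c * g⁻¹) = g * ((g⁻¹ * u * g) * c) * g⁻¹ := by group
    _ = g * (c * (g⁻¹ * u * g)) * g⁻¹ := by rw [h]
    _ = g * c * g⁻¹ * u := by group

/-- The group `E_G^Ḡ(P_γ) = N_G(P_γ)/C_H(P)` of `(G, Ḡ)`-fusions of `P_γ`. -/
abbrev E (P : Subgroup G) (γ : Set (S.fixed P)) : Type _ :=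
  S.pointNormalizer P γ ⧸ S.pointCentralizer P γ

/-! #### The normalizer of `Pi` in the homogeneous units of `iAi` -/

section Corner

variable {P : Subgroup G} (i : S.fixed P) (hi : IsIdempotentElem (i : A))

/-- The `Ḡ`-grading of `iAi`. -/
def cornerGrading : GroupGrading O (G ⧸ H) hi.Corner :=
  S.toGroupGrading.corner hi i.2.1

/-- The structural homomorphism `P → (iAi)ˣ`, `u ↦ u i = i u i`. -/
def cornerMap : P →* (hi.Corner)ˣ :=
  MonoidHom.toHomUnits
    { toFun := fun u => ⟨i * S.σ u * i, S.σ u, rfl⟩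
      map_one' := Subtype.ext (by
        change (i : A) * S.σ ((1 : P) : G) * i = i
        simp [hi.eq])
      map_mul' := fun u v => Subtype.ext (by
        change (i : A) * S.σ ((u * v : P) : G) * i = (i * S.σ u * i) * (i * S.σ v * i)
        have hu := S.fixed_comm i u.2
        have hv := S.fixed_comm i v.2
        rw [Subgroup.coe_mul, map_mul]
        calc (i : A) * (S.σ u * S.σ v) * i = i * S.σ u * (S.σ v * i) := by simp only [mul_assoc]
          _ = i * S.σ u * (i * S.σ v) := by rw [hv]
          _ = i * S.σ u * (i * i * (S.σ v * i)) := by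
            rw [hv, hi.eq, ← mul_assoc (i : A) (i : A), hi.eq]
          _ = (i * S.σ u * i) * (i * S.σ v * i) := by simp only [mul_assoc]) }

/-- The subgroup `Pi` of `(iAi)ˣ`. -/
def Pi : Subgroup (hi.Corner)ˣ := (S.cornerMap i hi).range

/-- The group `N_{hU(iAi)}(Pi)`. -/
def hUNormalizer : Subgroup (hi.Corner)ˣ :=
  (S.cornerGrading i hi).hU ⊓ Subgroup.normalizer (S.Pi i hi : Set (hi.Corner)ˣ)

/-- The group `C_{(iBi)ˣ}(Pi)`. -/
def unitCentralizer : Subgroup (hi.Corner)ˣ :=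
  (S.cornerGrading i hi).oneUnits ⊓ Subgroup.centralizer (S.Pi i hi : Set (hi.Corner)ˣ)

/-- `C_{(iBi)ˣ}(Pi)` is contained in `N_{hU(iAi)}(Pi)`. -/
theorem unitCentralizer_le : S.unitCentralizer i hi ≤ S.hUNormalizer i hi := fun _ ha =>
  ⟨⟨1, ha.1.1⟩, Subgroup.centralizer_le_normalizer _ ha.2⟩

instance unitCentralizer_normal :
    ((S.unitCentralizer i hi).subgroupOf (S.hUNormalizer i hi)).Normal := by
  constructor
  rintro ⟨c, hc⟩ hcm ⟨n, hn⟩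
  obtain ⟨⟨x, hx⟩, hn2⟩ := hn
  have hcm' : c ∈ S.unitCentralizer i hi := hcm
  obtain ⟨⟨hc1, hc2⟩, hc3⟩ := hcm'
  have hinv := (S.cornerGrading i hi).inv_mem n hx
  change n * c * n⁻¹ ∈ S.unitCentralizer i hi
  refine ⟨⟨?_, ?_⟩, ?_⟩
  · simpa using (S.cornerGrading i hi).mul_mem ((S.cornerGrading i hi).mul_mem hx hc1) hinv
  · simpa [mul_assoc] using
      (S.cornerGrading i hi).mul_mem hx ((S.cornerGrading i hi).mul_mem hc2 hinv)
  · refine Subgroup.mem_centralizer_iff.2 fun u hu => ?_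
    have hn1 : n⁻¹ ∈ Subgroup.normalizer (S.Pi i hi : Set (hi.Corner)ˣ) := inv_mem hn2
    have hu' : n⁻¹ * u * n ∈ (S.Pi i hi : Set (hi.Corner)ˣ) := by
      simpa using (Subgroup.mem_normalizer_iff.1 hn1 u).1 hu
    have h := Subgroup.mem_centralizer_iff.1 hc3 _ hu'
    calc u * (n * c * n⁻¹) = n * ((n⁻¹ * u * n) * c) * n⁻¹ := by group
      _ = n * (c * (n⁻¹ * u * n)) * n⁻¹ := by rw [h]
      _ = n * c * n⁻¹ * u := by group

/-- The group `N_{hU(iAi)}(Pi) / C_{(iBi)ˣ}(Pi)`. -/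
abbrev NmodC : Type _ :=
  S.hUNormalizer i hi ⧸ (S.unitCentralizer i hi).subgroupOf (S.hUNormalizer i hi)

end Corner

/-! #### `(A, Ḡ)`-fusions -/

section Fusion

variable {P : Subgroup G} (i : S.fixed P)

/-- The left `A`-module `Ai`. Its `x`-component is `Ai ∩ A_x = A_x i`, for `x ∈ Ḡ`. -/
def bimod : Submodule A A := Submodule.span A {(i : A)}

/-- The right action of `u ∈ P` on `Ai`; with the left action of `A` it makes `Ai` into an
`(A, OP)`-bimodule. -/
def bimodRight (u : P) (m : S.bimod i) : S.bimod i :=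
  ⟨m * S.σ u, by
    obtain ⟨a, ha⟩ := Submodule.mem_span_singleton.1 m.2
    refine Submodule.mem_span_singleton.2 ⟨a * S.σ u, ?_⟩
    rw [← ha, smul_eq_mul, smul_eq_mul, mul_assoc, mul_assoc, S.fixed_comm i u.2]⟩

/-- `f` is an isomorphism `Ai → (Ai)(ḡ⁻¹)_φ` of `Ḡ`-graded `(A, OP)`-bimodules, where
`α = (φ, ḡ)`. The target is `Ai` as a left `A`-module, an element `u ∈ P` acts on it from the right
as `φ u` does on `Ai`, and its `x`-component is the `xḡ⁻¹`-component of `Ai`. -/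
def IsFusionIso (α : MulAut P × (G ⧸ H)) (f : S.bimod i ≃ₗ[A] S.bimod i) : Prop :=
  (∀ (u : P) (m : S.bimod i), f (S.bimodRight i u m) = S.bimodRight i (α.1 u) (f m)) ∧
  ∀ (x : G ⧸ H) (m : S.bimod i), (m : A) ∈ S.comp x ↔ (f m : A) ∈ S.comp (x * α.2⁻¹)

/-- The group `F_A^Ḡ(P_γ)` of `(A, Ḡ)`-fusions of `P_γ`, for `i ∈ γ`: the pairs
`(φ, ḡ) ∈ Aut^Ḡ(P)` such that `Ai ≃ (Ai)(ḡ⁻¹)_φ` as `Ḡ`-graded `(A, OP)`-bimodules. -/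
def F : Subgroup (autBar H P) where
  carrier := {α | ∃ f : S.bimod i ≃ₗ[A] S.bimod i, S.IsFusionIso i α.1 f}
  one_mem' := ⟨LinearEquiv.refl A _, fun _ _ => rfl, fun x m => by simp⟩
  mul_mem' := by
    rintro ⟨α, hα⟩ ⟨β, hβ⟩ ⟨f, hf, hf'⟩ ⟨g, hg, hg'⟩
    refine ⟨g.trans f, fun u m => ?_, fun x m => ?_⟩
    · simp only [LinearEquiv.trans_apply, hg, hf]
      rfl
    · simp only [LinearEquiv.trans_apply]
      rw [hg' x m, hf']
      simp [mul_assoc]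
  inv_mem' := by
    rintro ⟨α, hα⟩ ⟨f, hf, hf'⟩
    refine ⟨f.symm, fun u m => ?_, fun x m => ?_⟩
    · rw [LinearEquiv.symm_apply_eq, hf]
      simp
    · have h := hf' (x * α.2) (f.symm m)
      simp only [mul_inv_cancel_right, LinearEquiv.apply_symm_apply] at h
      simpa using h.symm

end Fusion

end InteriorAlgebra

/-! ### Block extensions -/

section Block

variable (O : Type*) {G : Type*} [CommRing O] [Group G] (H : Subgroup G)

/-- The `O`-submodule of `OG` of the elements supported on the coset `x ∈ Ḡ = G/H`. -/
def cosetComp (x : G ⧸ H) : Submodule O (MonoidAlgebra O G) where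
  carrier := {a | ∀ g : G, (g : G ⧸ H) ≠ x → a.coeff g = 0}
  zero_mem' := by intro g _; simp
  add_mem' := by intro a c ha hc g hg; simp [ha g hg, hc g hg]
  smul_mem' := by intro r a ha g hg; simp [ha g hg]

theorem single_mem_cosetComp (g : G) (r : O) :
    MonoidAlgebra.single g r ∈ cosetComp O H (g : G ⧸ H) := by
  intro h hne
  have : g ≠ h := by rintro rfl; exact hne rfl
  simp [this]

/-- The `Ḡ`-grading of `OG`. -/
def groupAlgebraGrading [H.Normal] : GroupGrading O (G ⧸ H) (MonoidAlgebra O G) where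
  comp := cosetComp O H
  one_mem := single_mem_cosetComp O H 1 1
  mul_mem := by
    classical
    intro x y a c ha hc g hg
    rw [MonoidAlgebra.coeff_mul]
    refine Finset.sum_eq_zero fun u _ => Finset.sum_eq_zero fun v _ => ?_
    beta_reduce
    split_ifs with huv
    · by_cases hu : (u : G ⧸ H) = x
      · by_cases hv : (v : G ⧸ H) = y
        · exact absurd (by rw [← huv, ← hu, ← hv]; rfl) hg
        · simp [hc v hv]
      · simp [ha u hu]
    · rfl
  indep := by
    intro x
    rw [Submodule.disjoint_def]
    intro a ha ha'
    let N : Submodule O (MonoidAlgebra O G) :=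
      { carrier := {a | ∀ g : G, (g : G ⧸ H) = x → a.coeff g = 0}
        zero_mem' := by intro g _; simp
        add_mem' := by intro a c ha hc g hg; simp [ha g hg, hc g hg]
        smul_mem' := by intro r a ha g hg; simp [ha g hg] }
    have hle : (⨆ (y) (_ : y ≠ x), cosetComp O H y) ≤ N :=
      iSup₂_le fun y hy c hc g hg => hc g (by rw [hg]; exact hy.symm)
    have haN : a ∈ N := hle ha'
    ext g
    by_cases hg : (g : G ⧸ H) = x
    · simpa using haN g hg
    · simpa using ha g hg
  iSup_eq_top := by
    rw [eq_top_iff]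
    intro a _
    induction a using MonoidAlgebra.induction_linear with
    | zero => exact Submodule.zero_mem _
    | add a c ha hc => exact Submodule.add_mem _ (ha trivial) (hc trivial)
    | single g r => exact Submodule.mem_iSup_of_mem (g : G ⧸ H) (single_mem_cosetComp O H g r)

/-- A `G`-invariant block of `OH`: a primitive idempotent `b` of the center of `OH` such that
`g b g⁻¹ = b` in `OG`, for all `g ∈ G`. -/
structure InvariantBlock where
  /-- The block idempotent. -/
  b : Subring.center (MonoidAlgebra O H)
  primitive : IsPrimitiveIdempotent b
  invariant : ∀ g : G,
    MonoidAlgebra.of O G g * MonoidAlgebra.mapDomain H.subtype b.1 * MonoidAlgebra.of O G g⁻¹ =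
      MonoidAlgebra.mapDomain H.subtype b.1

namespace InvariantBlock

variable {O H} (b : InvariantBlock O H)

/-- The block idempotent as an element of `OG`. -/
def idem : MonoidAlgebra O G := MonoidAlgebra.mapDomain H.subtype b.b.1

theorem isIdempotentElem_idem : IsIdempotentElem b.idem := by
  have h : b.b.1 * b.b.1 = b.b.1 := congrArg Subtype.val b.primitive.1.eq
  rw [IsIdempotentElem, idem, ← MonoidAlgebra.mapDomain_mul, h]

theorem of_mul_idem (g : G) :
    MonoidAlgebra.of O G g * b.idem = b.idem * MonoidAlgebra.of O G g := by
  have h : MonoidAlgebra.of O G g⁻¹ * MonoidAlgebra.of O G g = 1 := by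
    rw [← map_mul, inv_mul_cancel, map_one]
  conv_rhs => rw [idem, ← b.invariant g, mul_assoc, h, mul_one]
  rfl

theorem idem_mem [H.Normal] : b.idem ∈ (groupAlgebraGrading O H).comp 1 := by
  intro g hg
  rw [idem, MonoidAlgebra.mapDomain]
  refine Finsupp.mapDomain_of_notMem_range _ _ ?_
  rintro ⟨h, rfl⟩
  exact hg ((QuotientGroup.eq_one_iff _).2 h.2)

/-- The block extension `A = OGb`. As `b` is central in `OG`, it is the corner `b(OG)b`; it is an
`O`-algebra with identity `b`. -/
abbrev A : Type _ := b.isIdempotentElem_idem.Corner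

/-- The block extension `A = OGb` as a `Ḡ`-graded `G`-interior algebra, with structural map
`g ↦ gb`. Its identity component is `B = OHb`. -/
def extension [H.Normal] : InteriorAlgebra O b.A H where
  toGroupGrading := (groupAlgebraGrading O H).corner b.isIdempotentElem_idem b.idem_mem
  σ :=
    { toFun := fun g => ⟨b.idem * MonoidAlgebra.of O G g * b.idem, _, rfl⟩
      map_one' := Subtype.ext (by
        change b.idem * MonoidAlgebra.of O G 1 * b.idem = b.idem
        rw [map_one, mul_one, b.isIdempotentElem_idem.eq])
      map_mul' := fun g h => Subtype.ext (by
        change b.idem * MonoidAlgebra.of O G (g * h) * b.idem =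
          (b.idem * MonoidAlgebra.of O G g * b.idem) * (b.idem * MonoidAlgebra.of O G h * b.idem)
        have hb := b.isIdempotentElem_idem.eq
        symm
        calc _ = b.idem * (MonoidAlgebra.of O G g * b.idem) *
              (b.idem * MonoidAlgebra.of O G h * b.idem) := by simp only [mul_assoc]
          _ = (b.idem * b.idem) * MonoidAlgebra.of O G g * (b.idem * MonoidAlgebra.of O G h *
              b.idem) := by rw [b.of_mul_idem g]; simp only [mul_assoc]
          _ = b.idem * (MonoidAlgebra.of O G g * b.idem) *
              (MonoidAlgebra.of O G h * b.idem) := by rw [hb]; simp only [mul_assoc]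
          _ = (b.idem * b.idem) * (MonoidAlgebra.of O G g * MonoidAlgebra.of O G h) *
              b.idem := by rw [b.of_mul_idem g]; simp only [mul_assoc]
          _ = _ := by rw [hb, map_mul]) }
  σ_mem g := by
    change b.idem * MonoidAlgebra.of O G g * b.idem ∈ (groupAlgebraGrading O H).comp _
    have hg : MonoidAlgebra.of O G g ∈ (groupAlgebraGrading O H).comp (g : G ⧸ H) :=
      single_mem_cosetComp O H g 1
    simpa using (groupAlgebraGrading O H).mul_mem
      ((groupAlgebraGrading O H).mul_mem b.idem_mem hg) b.idem_mem

end InvariantBlock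

end Block

end GradedFusion

end

/-! Both quotients are compared with `F`, as pairs (automorphism of `P`, degree). An `A`-linear
automorphism of `Ai` is right multiplication by a unit of `iAi`. Compatibility with the twisted
right action of `P` and with the shifted grading says that the inverse of this unit normalizes `Pi`,
induces `φ`, and is homogeneous of degree `ḡ`. Hence `N_{hU(iAi)}(Pi)` maps onto `F`
(`fusionHom_surjective`), with kernel `C_{(iBi)ˣ}(Pi)`. To read an automorphism of `P` off an action
on `Pi`, the map `u ↦ ui` must be injective (`cornerMap_injective`, a Nakayama argument).

On the group side, `g ↦ (c_g, ḡ)` has kernel `C_H(P)`, and it lands in `F` because `i a⁻¹ g` is a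
homogeneous unit inducing `c_g`. The substance is its surjectivity. Let `n` be homogeneous of degree
`y` and induce `φ`. Expand `n = ∑ n_x x` over the coset `y`, so that `i = ∑ n_x x n⁻¹`. The summands
form an equivariant family for the action `u · x = u x φ⁻¹(u)⁻¹` of `P` on `G`. Without a fixed
point in `y`, the sum would consist of traces from proper subgroups, contrary to `Br_P(i) ≠ 0`; so
some `x ∈ y` satisfies `φ(u) = x u x⁻¹` (`exists_conj_of_hUNormalizer`).

Such an `x` normalizes `P`, and `n x⁻¹`, `x n⁻¹` in `B^P` exhibit `i` and `ˣi` as isomorphic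
idempotents. As `B^P` is finite over a complete local ring, the primitive idempotent `i` has a local
corner ring, and isomorphism implies conjugacy (`IsPrimitiveIdempotent.isConj`). Thus `x ∈
N_G(P_γ)`. -/

noncomputable section

namespace GradedFusion

/-! ### Conjugacy of isomorphic idempotents in a ring. -/

section Idempotents

variable {R : Type*} [Ring R] {e f : R}

/-- Idempotents which generate the same left ideal are conjugate. -/
theorem isConj_of_mul_eq_right (he : e * e = e) (hf : f * f = f) (hef : e * f = e)
    (hfe : f * e = f) : IsConj e f := by
  refine ⟨⟨1 + (f - e), 1 - (f - e), ?_, ?_⟩, ?_⟩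
  · simp only [add_mul, mul_sub, sub_mul, he, hf, hef, hfe, one_mul, mul_one]; abel
  · simp only [mul_add, mul_sub, sub_mul, he, hf, hef, hfe, one_mul, mul_one]; abel
  · change (1 + (f - e)) * e = f * (1 + (f - e))
    simp only [mul_add, add_mul, mul_sub, sub_mul, he, hf, hfe, one_mul, mul_one]; abel

/-- Idempotents which generate the same right ideal are conjugate. -/
theorem isConj_of_mul_eq_left (he : e * e = e) (hf : f * f = f) (hef : e * f = f)
    (hfe : f * e = e) : IsConj e f := by
  refine ⟨⟨1 + (e - f), 1 - (e - f), ?_, ?_⟩, ?_⟩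
  · simp only [add_mul, mul_sub, sub_mul, he, hf, hef, hfe, one_mul, mul_one]; abel
  · simp only [mul_add, mul_sub, sub_mul, he, hf, hef, hfe, one_mul, mul_one]; abel
  · change (1 + (e - f)) * e = f * (1 + (e - f))
    simp only [mul_add, add_mul, mul_sub, sub_mul, he, hf, hfe, one_mul, mul_one]; abel

/-- If `v` is inverse to `efe` in `eRe`, and `fvf = f`, then `e` and `f` are conjugate. -/
theorem isConj_of_isUnit_corner {v : R} (he : e * e = e) (hf : f * f = f) (hev : e * v = v)
    (hve : v * e = v) (hv : e * f * e * v = e) (hfv : f * v * f = f) : IsConj e f := by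
  have h : f * v * (f * v) = f * v := by rw [← mul_assoc, hfv]
  -- The idempotent `f * v` interpolates: it generates the left ideal of `e` and the right ideal of
  -- `f`.
  refine (isConj_of_mul_eq_right (f := f * v) he h ?_ ?_).trans
    (isConj_of_mul_eq_left h hf hfv ?_)
  · rw [← hev, ← mul_assoc, ← mul_assoc, hv]
  · rw [mul_assoc, hve]
  · rw [← mul_assoc, hf]

/-- Orthogonal isomorphic idempotents are conjugate. -/
theorem isConj_of_orthogonal {c d : R} (hec : e * c = c) (hcf : c * f = c) (hfd : f * d = d)
    (hde : d * e = d) (hcd : c * d = e) (hdc : d * c = f) (hef : e * f = 0) (hfe : f * e = 0) :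
    IsConj e f := by
  have he : e * e = e := by nth_rw 2 [← hcd]; rw [← mul_assoc, hec, hcd]
  have hf : f * f = f := by nth_rw 2 [← hdc]; rw [← mul_assoc, hfd, hdc]
  have hed : e * d = 0 := by rw [← hfd, ← mul_assoc, hef, zero_mul]
  have hfc : f * c = 0 := by rw [← hec, ← mul_assoc, hfe, zero_mul]
  have hdf : d * f = 0 := by rw [← hde, mul_assoc, hef, mul_zero]
  have hce : c * e = 0 := by rw [← hcf, mul_assoc, hfe, mul_zero]
  have hcc : c * c = 0 := by nth_rw 2 [← hec]; rw [← mul_assoc, hce, zero_mul]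
  have hdd : d * d = 0 := by nth_rw 2 [← hfd]; rw [← mul_assoc, hdf, zero_mul]
  -- This element swaps `e` and `f` and is the identity on the complement `1 - e - f`; it is its own
  -- inverse.
  have hs : (c + d + (1 - e - f)) * (c + d + (1 - e - f)) = 1 := by
    simp only [mul_add, add_mul, mul_sub, sub_mul, he, hf, hec, hcf, hfd, hde, hcd, hdc, hef, hfe,
      hed, hfc, hdf, hce, hcc, hdd, one_mul, mul_one]
    abel
  refine ⟨⟨_, _, hs, hs⟩, ?_⟩
  change (c + d + (1 - e - f)) * e = f * (c + d + (1 - e - f))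
  simp only [mul_add, add_mul, mul_sub, sub_mul, he, hf, hfd, hde, hfe, hfc, hce, one_mul,
    mul_one]
  abel

/-- An idempotent isomorphic to an idempotent with local corner ring is conjugate to it. -/
theorem isConj_of_isLocalRing_corner (he : IsIdempotentElem e) [IsLocalRing he.Corner]
    {c d : R} (hec : e * c = c) (hcf : c * f = c) (hfd : f * d = d) (hde : d * e = d)
    (hcd : c * d = e) (hdc : d * c = f) : IsConj e f := by
  have hf : f * f = f := by nth_rw 2 [← hdc]; rw [← mul_assoc, hfd, hdc]
  have hloc : ∀ a : R, e * a = a → a * e = a →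
      (∃ v, e * v = v ∧ v * e = v ∧ a * v = e ∧ v * a = e) ∨
      (∃ v, e * v = v ∧ v * e = v ∧ (e - a) * v = e ∧ v * (e - a) = e) := by
    intro a h1 h2
    have key : ∀ x : he.Corner, IsUnit x →
        ∃ v, e * v = v ∧ v * e = v ∧ x.1 * v = e ∧ v * x.1 = e := by
      rintro _ ⟨x, rfl⟩
      exact ⟨(x⁻¹).1.1, corner_mul_left he _, corner_mul_right he _,
        congrArg Subtype.val x.mul_inv, congrArg Subtype.val x.inv_mul⟩
    let a' : he.Corner := ⟨a, (Subsemigroup.mem_corner_iff he).2 ⟨h1, h2⟩⟩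
    exact (IsLocalRing.isUnit_or_isUnit_of_add_one (add_sub_cancel a' 1)).imp (key _) (key _)
  -- The case where `efe` is invertible in `eRe`, with inverse `v`. Then `fvf` is an idempotent, and
  -- it remains to see that it equals `f`.
  have key : ∀ {f' c' d' v : R}, f' * f' = f' → e * c' = c' → c' * f' = c' → f' * d' = d' →
      d' * e = d' → c' * d' = e → d' * c' = f' → e * v = v → v * e = v →
      e * f' * e * v = e → v * (e * f' * e) = e → IsConj e f' := by
    intro f c d v hf hec hcf hfd hde hcd hdc hev hve hv hv'
    refine isConj_of_isUnit_corner he hf hev hve hv ?_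
    have hvfv : v * f * v = v := by
      calc v * f * v = v * (e * f * e) * v := by
            nth_rw 1 [← hve]; nth_rw 2 [← hev]; simp only [mul_assoc]
        _ = v := by rw [hv', hev]
    -- The isomorphism `fRf ≃ eRe` carries `fvf` to `s`; an idempotent of the local ring `eRe` is
    -- `0` or `e`.
    set s := c * (f * v * f) * d with hs
    have hss : s * s = s := by
      calc s * s = c * (f * v * f) * (d * c) * (f * v * f) * d := by simp only [hs, mul_assoc]
        _ = c * (f * v * (f * (f * f)) * v * f) * d := by rw [hdc]; simp only [mul_assoc]
        _ = c * (f * (v * f * v) * f) * d := by rw [hf, hf]; simp only [mul_assoc]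
        _ = s := by rw [hvfv]
    have hes : e * s = s := by rw [hs, ← mul_assoc, ← mul_assoc, hec]
    have hse : s * e = s := by rw [hs, mul_assoc, hde]
    have ht : f * v * f = d * s * c := by
      calc f * v * f = f * (f * v * f) * f := by
            rw [mul_assoc, mul_assoc, mul_assoc, mul_assoc, hf, ← mul_assoc f f, hf]
        _ = (d * c) * (f * v * f) * (d * c) := by rw [hdc]
        _ = _ := by simp only [hs, mul_assoc]
    rcases hloc s hes hse with ⟨w, -, hwe, hw, -⟩ | ⟨w, -, -, hw, -⟩
    · have : s = e := by rw [← hse, ← hw, ← mul_assoc, hss]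
      rw [ht, this, hde, hdc]
    · have hs0 : s = 0 := by
        rw [← hse, ← hw, ← mul_assoc, mul_sub, hse, hss, sub_self, zero_mul]
      have h0 : f * v * f = 0 := by rw [ht, hs0, mul_zero, zero_mul]
      -- The square of `efev = e` factors through `fvf`, so `fvf = 0` forces `e = 0`.
      have he0 : e = 0 := by
        have : e * (f * v * f) * e * v = e := by
          calc e * (f * v * f) * e * v = e * f * (e * v) * f * e * v := by
                rw [hev]; simp only [mul_assoc]
            _ = (e * f * e * v) * (f * e * v) := by simp only [mul_assoc]
            _ = e := by rw [hv, ← mul_assoc, ← mul_assoc, hv]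
        rw [← this, h0, mul_zero, zero_mul, zero_mul]
      rw [h0, ← hdc, ← hec, he0, zero_mul, mul_zero]
  rcases hloc (e * f * e) (by rw [← mul_assoc, ← mul_assoc, he.eq]) (by rw [mul_assoc, he.eq]) with
    ⟨v, hev, hve, hv, hv'⟩ | ⟨v, hev, hve, hv, hv'⟩
  · exact key hf hec hcf hfd hde hcd hdc hev hve hv hv'
  -- Since `eRe` is local, `eqe` is now invertible, with inverse `v`. The idempotent `h = qvq` is
  -- isomorphic to `e` and orthogonal to `f`: the first case gives `e ~ h`, and the swap of
  -- orthogonal idempotents gives `h ~ f`.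
  · set q := 1 - f with hq
    have hqq : q * q = q := by simp [hq, mul_sub, sub_mul, hf]
    have hfq : f * q = 0 := by simp [hq, mul_sub, hf]
    have hqf : q * f = 0 := by simp [hq, sub_mul, hf]
    have heq : e - e * f * e = e * q * e := by simp [hq, mul_sub, sub_mul, he.eq]
    rw [heq] at hv hv'
    have hvqv : v * q * v = v := by
      calc v * q * v = v * (e * q * e) * v := by
            nth_rw 1 [← hve]; nth_rw 2 [← hev]; simp only [mul_assoc]
        _ = v := by rw [hv', hev]
    have hqq' (x : R) : q * (q * x) = q * x := by rw [← mul_assoc, hqq]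
    have hvqv'' : v * (q * v) = v := by rw [← mul_assoc, hvqv]
    have hvqv' (x : R) : v * (q * (v * x)) = v * x := by
      rw [← mul_assoc q, ← mul_assoc, ← mul_assoc, hvqv]
    have hve' (x : R) : v * (e * x) = v * x := by rw [← mul_assoc, hve]
    have hv2 : e * (q * v) = e := by
      rw [← hev, ← mul_assoc, ← mul_assoc, hv]
    have hv2' : v * (q * e) = e := by
      rw [← hve, mul_assoc v e, ← mul_assoc e, hv']
    have hv3 (x : R) : e * (q * (v * x)) = e * x := by
      rw [← mul_assoc q, ← mul_assoc, hv2]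
    have hdqv (x : R) : d * (q * (v * x)) = d * x := by
      rw [← hde, mul_assoc, hv3, mul_assoc]
    let h := q * v * q
    have hh : h * h = h := by simp only [h, mul_assoc, hqq', hvqv']
    have hfh : f * h = 0 := by simp only [h, ← mul_assoc, hfq, zero_mul]
    have hhf : h * f = 0 := by simp only [h, mul_assoc, hqf, mul_zero]
    have h1 : IsConj e h := by
      refine key (c' := e * q) (d' := q * v) (v := v) hh ?_ ?_ ?_ ?_ ?_ ?_ hev hve ?_ ?_
      · rw [← mul_assoc, he.eq]
      all_goals simp only [h, mul_assoc, hqq', hvqv'', hve', hev, hve, hv2, hv2', hv3]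
    refine h1.trans (isConj_of_orthogonal (c := q * v * c) (d := d * q) ?_ ?_ ?_ ?_ ?_ ?_ hhf hfh)
    · simp only [h, mul_assoc, hqq', hvqv']
    · rw [mul_assoc, hcf]
    · rw [← mul_assoc, hfd]
    · simp only [h, mul_assoc, hqq', hdqv]
    · rw [mul_assoc, ← mul_assoc c, hcd, ← mul_assoc, mul_assoc q v e, hve]
    · rw [mul_assoc, mul_assoc, hqq', hdqv, hdc]

end Idempotents

/-! ### Local corner rings of finite algebras over a complete local ring. -/

section Complete

open IsLocalRing

/-- A finite module over an adically complete ring is complete. -/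
theorem isAdicComplete_of_finite {O : Type*} [CommRing O] [IsLocalRing O] [IsNoetherianRing O]
    [IsAdicComplete (maximalIdeal O) O] (M : Type*) [AddCommGroup M] [Module O M]
    [Module.Finite O M] : IsAdicComplete (maximalIdeal O) M := by
  rw [← AdicCompletion.of_bijective_iff]
  refine ⟨(AdicCompletion.of_injective_iff).2 inferInstance, fun y => ?_⟩
  -- For finite `M` the completion is a quotient of `Ô ⊗ M`, and every element of `Ô` comes from
  -- `O`.
  obtain ⟨t, rfl⟩ := AdicCompletion.ofTensorProduct_surjective_of_finite (maximalIdeal O) M y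
  induction t using TensorProduct.induction_on with
  | zero => exact ⟨0, by simp⟩
  | add s t hs ht =>
    obtain ⟨a, ha⟩ := hs
    obtain ⟨c, hc⟩ := ht
    exact ⟨a + c, by rw [map_add, map_add, ha, hc]⟩
  | tmul r x =>
    obtain ⟨r, rfl⟩ := (AdicCompletion.of_bijective_iff.2 ‹_›).2 r
    refine ⟨r • x, ?_⟩
    rw [AdicCompletion.ofTensorProduct_tmul, map_smul]
    ext n
    rfl

/-- Modulo the maximal ideal of `O` the algebra is Artinian, so a Fitting argument attaches to each
element an idempotent which is `1` when the element is invertible and `0` when it is nilpotent.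
Hensel's lemma lifts this idempotent to `C`, where only `0` and `1` are available. -/
theorem isLocalRing_of_finite_of_comm {O C : Type*} [CommRing O] [IsLocalRing O]
    [IsNoetherianRing O] [IsAdicComplete (maximalIdeal O) O] [CommRing C] [Nontrivial C]
    [Algebra O C] [Module.Finite O C]
    (h : ∀ x : C, IsIdempotentElem x → x = 0 ∨ x = 1) : IsLocalRing C := by
  set I := (maximalIdeal O).map (algebraMap O C)
  have : IsAdicComplete I C :=
    (IsAdicComplete.map_algebraMap_iff _ _).2 (isAdicComplete_of_finite C)
  have : IsArtinianRing (C ⧸ I) := by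
    have : Module.Finite (O ⧸ maximalIdeal O) (C ⧸ I) :=
      Module.Finite.of_restrictScalars_finite O _ _
    let := Ideal.Quotient.field (maximalIdeal O)
    exact IsArtinianRing.of_finite (O ⧸ maximalIdeal O) _
  have hloc := isLocalHom_of_le_jacobson_bot I (IsAdicComplete.le_jacobson_bot I)
  refine IsLocalRing.of_isUnit_or_isUnit_one_sub_self fun a => ?_
  -- The descending chain of ideals `(xⁿ)` stabilizes; then `xⁿ zⁿ` is the Fitting idempotent of
  -- `x`.
  obtain ⟨n, y, hy⟩ := IsArtinian.exists_pow_succ_smul_dvd (Ideal.Quotient.mk I a) (1 : C ⧸ I)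
  obtain ⟨y, rfl⟩ := Ideal.Quotient.mk_surjective y
  set x := Ideal.Quotient.mk I a with hx
  set z := Ideal.Quotient.mk I y with hz
  replace hy : x ^ (n + 1) * z = x ^ n := by simpa using hy
  have hk (k : ℕ) : x ^ (n + k) * z ^ k = x ^ n := by
    induction k with
    | zero => simp
    | succ k ih =>
      calc x ^ (n + (k + 1)) * z ^ (k + 1) = (x ^ (n + 1) * z) * x ^ k * z ^ k := by ring
        _ = x ^ (n + k) * z ^ k := by rw [hy]; ring
        _ = x ^ n := ih
  have hidem : (x ^ n * z ^ n) * (x ^ n * z ^ n) = x ^ n * z ^ n := by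
    calc _ = (x ^ (n + n) * z ^ n) * z ^ n := by ring
      _ = _ := by rw [hk]
  -- Newton lifting applies to `X² - X`: its derivative `2X - 1` squares to `1` at an idempotent,
  -- hence is a unit there.
  obtain ⟨ε, hε, hε'⟩ := HenselianRing.is_henselian (I := I)
    (Polynomial.X ^ 2 - Polynomial.X : Polynomial C)
    (by monicity!) (a ^ n * y ^ n) (by
      rw [← Ideal.Quotient.eq_zero_iff_mem]
      simp [← hx, ← hz, sq, hidem]) (by
      have : (2 * (x ^ n * z ^ n) - 1) * (2 * (x ^ n * z ^ n) - 1) = 1 := by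
        linear_combination 4 * hidem
      refine IsUnit.of_mul_eq_one (2 * (x ^ n * z ^ n) - 1) ?_
      refine Eq.trans ?_ this
      simp [← hx, ← hz]
      ring)
  have hεi : IsIdempotentElem ε := by
    have : ε ^ 2 - ε = 0 := by simpa using hε
    rw [IsIdempotentElem]; linear_combination this
  have hεx : Ideal.Quotient.mk I ε = x ^ n * z ^ n := by
    have := Ideal.Quotient.eq.2 hε'
    simpa using this
  rcases h ε hεi with h0 | h1
  · right
    rw [h0, map_zero] at hεx
    have hn : x ^ n = 0 := by
      rw [← hk n, pow_add, mul_assoc, ← hεx, mul_zero]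
    apply hloc.map_nonunit
    rw [map_sub, map_one]
    exact IsNilpotent.isUnit_one_sub ⟨n, hn⟩
  · left
    apply hloc.map_nonunit
    rw [h1, map_one] at hεx
    -- For `n = 0` the idempotent carries no information, but the stabilization relation itself
    -- reads `x z = 1`.
    rcases Nat.eq_zero_or_pos n with rfl | hn
    · exact IsUnit.of_mul_eq_one z (by simpa using hy)
    · exact isUnit_of_dvd_unit (dvd_pow_self x hn.ne') (IsUnit.of_mul_eq_one _ hεx.symm)

/-- Invertibility of `a` or of `1 - a` can be tested in the commutative subalgebra `O[a]`, which is
finite because `O` is Noetherian. -/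
theorem isLocalRing_of_finite {O R : Type*} [CommRing O] [IsLocalRing O] [IsNoetherianRing O]
    [IsAdicComplete (maximalIdeal O) O] [Ring R] [Nontrivial R] [Algebra O R] [Module.Finite O R]
    (h : ∀ x : R, IsIdempotentElem x → x = 0 ∨ x = 1) : IsLocalRing R := by
  refine IsLocalRing.of_isUnit_or_isUnit_one_sub_self fun a => ?_
  let C := Algebra.adjoin O {a}
  have : IsMulCommutative C := Algebra.isMulCommutative_adjoin O (by simp)
  have : Module.Finite O C := Module.Finite.of_injective C.val.toLinearMap Subtype.val_injective
  have : IsLocalRing C := isLocalRing_of_finite_of_comm (O := O) fun x hx => by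
    refine (h x (congrArg Subtype.val hx.eq)).imp ?_ ?_ <;> exact fun h => Subtype.ext h
  let a' : C := ⟨a, Algebra.subset_adjoin rfl⟩
  exact (IsLocalRing.isUnit_or_isUnit_one_sub_self a').imp (fun h => h.map C.val)
    (fun h => h.map C.val)

/-- An idempotent `x` of `eRe` splits `e` as `x + (e - x)`, so primitivity leaves only the trivial
idempotents. -/
theorem isLocalRing_corner {O R : Type*} [CommRing O] [IsLocalRing O] [IsNoetherianRing O]
    [IsAdicComplete (maximalIdeal O) O] [Ring R] [Algebra O R] [Module.Finite O R] {e : R}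
    (he : IsPrimitiveIdempotent e) : IsLocalRing he.1.Corner := by
  have : Nontrivial he.1.Corner := ⟨⟨1, 0, fun h => he.2.1 (congrArg Subtype.val h)⟩⟩
  have : Module.Finite O he.1.Corner :=
    Module.Finite.of_surjective (cornerProj O he.1) fun c => ⟨c.1, Subtype.ext (by
      change e * c.1 * e = c.1
      rw [corner_mul_left, corner_mul_right])⟩
  refine isLocalRing_of_finite (O := O) fun x hx => ?_
  have hx' : x.1 * x.1 = x.1 := congrArg Subtype.val hx.eq
  have hex := corner_mul_left he.1 x
  have hxe := corner_mul_right he.1 x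
  refine (he.2.2 x.1 (e - x.1) hx' ?_ ?_ ?_ (add_sub_cancel _ _)).imp
    (fun h => Subtype.ext h) (fun h => Subtype.ext (sub_eq_zero.1 h).symm)
  · simp [IsIdempotentElem, mul_sub, sub_mul, hx', hex, hxe, he.1.eq]
  · simp [mul_sub, hx', hxe]
  · simp [hx', hex, sub_mul]

/-- A primitive idempotent of a finite algebra over a complete local ring is conjugate to every
idempotent isomorphic to it. -/
theorem IsPrimitiveIdempotent.isConj {O R : Type*} [CommRing O] [IsLocalRing O]
    [IsNoetherianRing O] [IsAdicComplete (maximalIdeal O) O] [Ring R] [Algebra O R]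
    [Module.Finite O R] {e f c d : R} (he : IsPrimitiveIdempotent e) (hec : e * c = c)
    (hcf : c * f = c) (hfd : f * d = d) (hde : d * e = d) (hcd : c * d = e) (hdc : d * c = f) :
    IsConj e f :=
  have := isLocalRing_corner (O := O) he
  isConj_of_isLocalRing_corner he.1 hec hcf hfd hde hcd hdc

end Complete

/-! ### Homogeneous units of `iAi` and graded bimodule automorphisms of `Ai`. -/

namespace GroupGrading

variable {O Γ A : Type*} [CommRing O] [Group Γ] [Ring A] [Algebra O A] (S : GroupGrading O Γ A)

theorem eq_of_mem_comp {a : A} (ha : a ≠ 0) {x y : Γ} (hx : a ∈ S.comp x) (hy : a ∈ S.comp y) :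
    x = y := by
  by_contra h
  exact ha (Submodule.disjoint_def.1 (S.indep.pairwiseDisjoint h) a hx hy)

/-- The degree of a homogeneous unit. -/
def degree [Nontrivial A] : S.hU →* Γ where
  toFun u := u.2.choose
  map_one' := S.eq_of_mem_comp one_ne_zero (1 : S.hU).2.choose_spec S.one_mem
  map_mul' u v := S.eq_of_mem_comp (u * v).1.ne_zero (u * v).2.choose_spec
    (S.mul_mem u.2.choose_spec v.2.choose_spec)

theorem mem_comp_degree [Nontrivial A] (u : S.hU) : (u.1 : A) ∈ S.comp (S.degree u) :=
  u.2.choose_spec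

end GroupGrading

namespace InteriorAlgebra

variable {O G A : Type*} [CommRing O] [Group G] {H : Subgroup G} [H.Normal] [Ring A] [Algebra O A]
variable (S : InteriorAlgebra O A H) {P : Subgroup G} (i : S.fixed P)
  (hi : IsIdempotentElem (i : A))

theorem coe_cornerMap (u : P) : (S.cornerMap i hi u).1.1 = i * S.σ u * i := rfl

theorem coe_cornerMap_eq_mul (u : P) : (S.cornerMap i hi u).1.1 = i * S.σ u := by
  rw [coe_cornerMap, mul_assoc, S.fixed_comm i u.2, ← mul_assoc, hi.eq]

theorem coe_cornerMap_eq_mul' (u : P) : (S.cornerMap i hi u).1.1 = S.σ u * i := by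
  rw [coe_cornerMap_eq_mul, S.fixed_comm i u.2]

theorem cornerMap_mem (u : P) :
    (S.cornerMap i hi u : hi.Corner) ∈ (S.cornerGrading i hi).comp ((u : G) : G ⧸ H) := by
  change (S.cornerMap i hi u).1.1 ∈ S.comp _
  simpa [coe_cornerMap_eq_mul] using S.mul_mem i.2.1 (S.σ_mem u)

/-- The automorphisms of `P ≃ Pi` induced by conjugation with elements of `N_{hU(iAi)}(Pi)`. -/
def cornerAut (hinj : Function.Injective (S.cornerMap i hi)) :
    S.hUNormalizer i hi →* MulAut P :=
  (MulAut.congr (MonoidHom.ofInjective hinj).symm).toMonoidHom.comp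
    ((S.Pi i hi).normalizerMonoidHom.comp (Subgroup.inclusion inf_le_right))

theorem cornerMap_cornerAut (hinj : Function.Injective (S.cornerMap i hi))
    (n : S.hUNormalizer i hi) (u : P) :
    S.cornerMap i hi (S.cornerAut i hi hinj n u) = n.1 * S.cornerMap i hi u * n.1⁻¹ := by
  have h : MonoidHom.ofInjective hinj (S.cornerAut i hi hinj n u) =
      (S.Pi i hi).normalizerMonoidHom (Subgroup.inclusion inf_le_right n)
        (MonoidHom.ofInjective hinj u) :=
    (MonoidHom.ofInjective hinj).apply_symm_apply _
  exact congrArg Subtype.val h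

theorem mem_bimod_iff {i : S.fixed P} (hi : IsIdempotentElem (i : A)) (m : A) :
    m ∈ S.bimod i ↔ m * i = m := by
  refine Submodule.mem_span_singleton.trans ⟨?_, fun h => ⟨m, h⟩⟩
  rintro ⟨a, rfl⟩
  rw [smul_eq_mul, mul_assoc, hi.eq]

variable {i} in
/-- Right multiplication by the inverse of a unit of `iAi`, as an automorphism of `Ai`. -/
def bimodMulInv (n : (hi.Corner)ˣ) : S.bimod i ≃ₗ[A] S.bimod i where
  toFun m := ⟨m * n⁻¹.1.1, by
    have := corner_mul_right hi n⁻¹.1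
    exact (S.mem_bimod_iff hi _).2 (by rw [mul_assoc, this])⟩
  invFun m := ⟨m * n.1.1, by
    have := corner_mul_right hi n.1
    exact (S.mem_bimod_iff hi _).2 (by rw [mul_assoc, this])⟩
  map_add' a c := Subtype.ext (add_mul _ _ _)
  map_smul' a c := Subtype.ext (mul_assoc _ _ _)
  left_inv m := by
    have h : n⁻¹.1.1 * n.1.1 = i := congrArg Subtype.val n.inv_mul
    exact Subtype.ext (by
      change m.1 * n⁻¹.1.1 * n.1.1 = m
      rw [mul_assoc, h, (S.mem_bimod_iff hi _).1 m.2])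
  right_inv m := by
    have h : n.1.1 * n⁻¹.1.1 = i := congrArg Subtype.val n.mul_inv
    exact Subtype.ext (by
      change m.1 * n.1.1 * n⁻¹.1.1 = m
      rw [mul_assoc, h, (S.mem_bimod_iff hi _).1 m.2])

/-- The inverse appears because `u n⁻¹ = n⁻¹ φ(u)` on `Ai`, and `n⁻¹` shifts degrees by `ḡ⁻¹`,
exactly the two twists in the target bimodule. -/
theorem isFusionIso_bimodMulInv {α : MulAut P × (G ⧸ H)} {n : (hi.Corner)ˣ}
    (hα : ∀ u, S.cornerMap i hi (α.1 u) = n * S.cornerMap i hi u * n⁻¹)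
    (hn : n.1.1 ∈ S.comp α.2) : S.IsFusionIso i α (S.bimodMulInv hi n) := by
  refine ⟨fun u m => Subtype.ext ?_, fun x m => ?_⟩
  · change m.1 * S.σ u * n⁻¹.1.1 = m.1 * n⁻¹.1.1 * S.σ (α.1 u)
    have h : n⁻¹ * S.cornerMap i hi (α.1 u) = S.cornerMap i hi u * n⁻¹ := by
      rw [hα]; group
    have h' : n⁻¹.1.1 * (S.cornerMap i hi (α.1 u)).1.1 = (S.cornerMap i hi u).1.1 * n⁻¹.1.1 :=
      congrArg (fun c : (hi.Corner)ˣ => c.1.1) h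
    rw [coe_cornerMap_eq_mul, coe_cornerMap_eq_mul', ← mul_assoc, mul_assoc (S.σ u),
      corner_mul_left, corner_mul_right] at h'
    rw [mul_assoc, mul_assoc, h']
  · have h1 : n.1 ∈ (S.cornerGrading i hi).comp α.2 := hn
    have h2 : n⁻¹.1.1 ∈ S.comp α.2⁻¹ := (S.cornerGrading i hi).inv_mem n h1
    refine ⟨fun hm => S.mul_mem hm h2, fun hm => ?_⟩
    have := S.mul_mem hm hn
    rw [inv_mul_cancel_right] at this
    have h3 : ((S.bimodMulInv hi n).symm ((S.bimodMulInv hi n) m)).1 ∈ S.comp x := this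
    rwa [LinearEquiv.symm_apply_apply] at h3

/-- The map from `N_{hU(iAi)}(Pi)` to the group of `(A, Ḡ)`-fusions, which sends `n` to the
automorphism of `P` induced by `n` and the degree of `n`. -/
def fusionHom (hinj : Function.Injective (S.cornerMap i hi)) [Nontrivial hi.Corner] :
    S.hUNormalizer i hi →* S.F i :=
  let δ : S.hUNormalizer i hi →* G ⧸ H :=
    (S.cornerGrading i hi).degree.comp (Subgroup.inclusion inf_le_left)
  have hδ (n : S.hUNormalizer i hi) : n.1.1 ∈ (S.cornerGrading i hi).comp (δ n) :=
    (S.cornerGrading i hi).mem_comp_degree _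
  (((S.cornerAut i hi hinj).prod δ).codRestrict (autBar H P) fun n u => by
    refine (S.cornerGrading i hi).eq_of_mem_comp (S.cornerMap i hi _).ne_zero
      (S.cornerMap_mem i hi (S.cornerAut i hi hinj n u)) ?_
    rw [cornerMap_cornerAut]
    exact (S.cornerGrading i hi).mul_mem ((S.cornerGrading i hi).mul_mem (hδ n)
      (S.cornerMap_mem i hi u)) ((S.cornerGrading i hi).inv_mem _ (hδ n))).codRestrict
    (S.F i) fun n => ⟨S.bimodMulInv hi n.1, S.isFusionIso_bimodMulInv i hi
      (S.cornerMap_cornerAut i hi hinj n) (hδ n)⟩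

section

variable (hinj : Function.Injective (S.cornerMap i hi)) [Nontrivial hi.Corner]

theorem cornerMap_fusionHom (n : S.hUNormalizer i hi) (u : P) :
    S.cornerMap i hi ((S.fusionHom i hi hinj n).1.1.1 u) =
      n.1 * S.cornerMap i hi u * n.1⁻¹ :=
  S.cornerMap_cornerAut i hi hinj n u

theorem mem_comp_fusionHom (n : S.hUNormalizer i hi) :
    n.1.1.1 ∈ S.comp (S.fusionHom i hi hinj n).1.1.2 :=
  (S.cornerGrading i hi).mem_comp_degree (Subgroup.inclusion inf_le_left n)

theorem fusionHom_eq {n : S.hUNormalizer i hi} {α : S.F i}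
    (hα : ∀ u, S.cornerMap i hi (α.1.1.1 u) = n.1 * S.cornerMap i hi u * n.1⁻¹)
    (hn : n.1.1.1 ∈ S.comp α.1.1.2) : S.fusionHom i hi hinj n = α := by
  refine Subtype.ext (Subtype.ext (Prod.ext (MulEquiv.ext fun u => hinj ?_) ?_))
  · rw [cornerMap_fusionHom, hα]
  · exact (S.cornerGrading i hi).eq_of_mem_comp n.1.ne_zero (S.mem_comp_fusionHom i hi hinj n) hn

theorem ker_fusionHom : (S.fusionHom i hi hinj).ker =
    (S.unitCentralizer i hi).subgroupOf (S.hUNormalizer i hi) := by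
  ext n
  rw [MonoidHom.mem_ker, Subgroup.mem_subgroupOf]
  constructor
  · intro h
    have h1 := S.mem_comp_fusionHom i hi hinj n
    have h2 := S.cornerMap_fusionHom i hi hinj n
    rw [h] at h1 h2
    have h1' : n.1.1 ∈ (S.cornerGrading i hi).comp 1 := h1
    refine ⟨⟨h1', by simpa using (S.cornerGrading i hi).inv_mem _ h1'⟩,
      Subgroup.mem_centralizer_iff.2 ?_⟩
    rintro _ ⟨u, rfl⟩
    exact eq_mul_inv_iff_mul_eq.1 (h2 u)
  · rintro ⟨⟨h1, -⟩, h2⟩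
    refine S.fusionHom_eq i hi hinj (fun u => ?_) h1
    exact eq_mul_inv_iff_mul_eq.2 (Subgroup.mem_centralizer_iff.1 h2 _ ⟨u, rfl⟩)

/-- An `A`-linear endomorphism of `Ai` is right multiplication by its value at `i`. The unit is `n =
f⁻¹(i)`, with inverse `f(i)`; evaluating the two fusion conditions at `i` gives its action on `Pi`
and its degree. -/
theorem fusionHom_surjective : Function.Surjective (S.fusionHom i hi hinj) := by
  rintro ⟨α, f, hf, hf'⟩
  have hii : (i : A) ∈ S.bimod i := (S.mem_bimod_iff hi _).2 hi.eq
  have key : ∀ f : S.bimod i ≃ₗ[A] S.bimod i, ∀ m : S.bimod i, (f m).1 = m.1 * (f ⟨i, hii⟩).1 := by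
    intro f m
    have : m = m.1 • (⟨i, hii⟩ : S.bimod i) :=
      Subtype.ext ((S.mem_bimod_iff hi _).1 m.2).symm
    conv_lhs => rw [this, map_smul]
    rfl
  set m := f ⟨i, hii⟩ with hm
  set n := f.symm ⟨i, hii⟩ with hn
  have him : i * m.1 = m.1 := (key f ⟨i, hii⟩).symm
  have hin : i * n.1 = n.1 := (key f.symm ⟨i, hii⟩).symm
  have hnm : n.1 * m.1 = i := by rw [hm, ← key, hn, LinearEquiv.apply_symm_apply]
  have hmn : m.1 * n.1 = i := by rw [hn, ← key, hm, LinearEquiv.symm_apply_apply]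
  let n' : (hi.Corner)ˣ :=
    { val := ⟨n.1, (Subsemigroup.mem_corner_iff hi).2 ⟨hin, (S.mem_bimod_iff hi _).1 n.2⟩⟩
      inv := ⟨m.1, (Subsemigroup.mem_corner_iff hi).2 ⟨him, (S.mem_bimod_iff hi _).1 m.2⟩⟩
      val_inv := Subtype.ext hnm
      inv_val := Subtype.ext hmn }
  have hα (u : P) : S.cornerMap i hi (α.1.1 u) = n' * S.cornerMap i hi u * n'⁻¹ := by
    have h1 : i * S.σ u * m.1 = m.1 * S.σ (α.1.1 u) := by
      have := congrArg Subtype.val (hf u ⟨i, hii⟩)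
      rwa [key] at this
    refine Units.ext (Subtype.ext ?_)
    change (S.cornerMap i hi (α.1.1 u)).1.1 = n.1 * (S.cornerMap i hi u).1.1 * m.1
    rw [coe_cornerMap_eq_mul, coe_cornerMap_eq_mul, mul_assoc, h1, ← mul_assoc, hnm]
  have hdeg : n'.1 ∈ (S.cornerGrading i hi).comp α.1.2 := by
    have h := (hf' 1 ⟨i, hii⟩).1 i.2.1
    rw [one_mul] at h
    have h' : n'⁻¹.1 ∈ (S.cornerGrading i hi).comp α.1.2⁻¹ := h
    simpa using (S.cornerGrading i hi).inv_mem _ h'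
  have hnorm : n' ∈ S.hUNormalizer i hi := by
    refine ⟨⟨_, hdeg⟩, Subgroup.mem_normalizer_iff.2 fun c => ?_⟩
    constructor
    · rintro ⟨u, rfl⟩
      exact ⟨_, hα u⟩
    · rintro ⟨u, hu⟩
      refine ⟨α.1.1⁻¹ u, ?_⟩
      have := hα (α.1.1⁻¹ u)
      rw [MulAut.apply_inv_self, hu] at this
      simpa using this.symm
  exact ⟨⟨n', hnorm⟩, S.fusionHom_eq i hi hinj hα hdeg⟩

/-- The isomorphism from `N_{hU(iAi)}(Pi)/C_{(iBi)ˣ}(Pi)` to the group of `(A, Ḡ)`-fusions. -/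
def fusionEquiv : S.NmodC i hi ≃* S.F i :=
  (QuotientGroup.quotientMulEquivOfEq (S.ker_fusionHom i hi hinj).symm).trans
    (QuotientGroup.quotientKerEquivOfSurjective _ (S.fusionHom_surjective i hi hinj))

theorem fusionEquiv_mk (n : S.hUNormalizer i hi) :
    S.fusionEquiv i hi hinj (QuotientGroup.mk n) = S.fusionHom i hi hinj n := rfl

end

end InteriorAlgebra

/-! ### Points, `N_G(P_γ)`, and its map to the fusion group. -/

theorem IsPrimitiveIdempotent.conj {R : Type*} [Ring R] {e : R} (he : IsPrimitiveIdempotent e)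
    (a : Rˣ) : IsPrimitiveIdempotent ((a : R) * e * ((a⁻¹ : Rˣ) : R)) := by
  have hmul : ∀ (a : Rˣ) (c d : R), (a : R) * (c * d) * ((a⁻¹ : Rˣ) : R) =
      (a * c * ((a⁻¹ : Rˣ) : R)) * (a * d * ((a⁻¹ : Rˣ) : R)) := by
    intro a c d
    simp only [mul_assoc, Units.inv_mul_cancel_left]
  have hzero : ∀ (a : Rˣ) (c : R), (a : R) * c * ((a⁻¹ : Rˣ) : R) = 0 → c = 0 := by
    intro a c h
    simpa using h
  refine ⟨?_, fun h => he.2.1 (hzero a e h), fun c d hc hd hcd hdc h => ?_⟩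
  · rw [IsIdempotentElem, ← hmul, he.1.eq]
  · have := he.2.2 (((a⁻¹ : Rˣ) : R) * c * (a⁻¹⁻¹ : Rˣ)) (((a⁻¹ : Rˣ) : R) * d * (a⁻¹⁻¹ : Rˣ))
      (by rw [IsIdempotentElem, ← hmul, hc.eq]) (by rw [IsIdempotentElem, ← hmul, hd.eq])
      (by rw [← hmul, hcd, mul_zero, zero_mul]) (by rw [← hmul, hdc, mul_zero, zero_mul])
      (by rw [← add_mul, ← mul_add, h]; simp [mul_assoc])
    exact this.imp (hzero _ _) (hzero _ _)

namespace InteriorAlgebra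

variable {O G A : Type*} [CommRing O] [Group G] {H : Subgroup G} [H.Normal] [Ring A] [Algebra O A]
variable {S : InteriorAlgebra O A H} {P : Subgroup G} {γ : Set (S.fixed P)}

theorem IsPoint.isPrimitiveIdempotent (hγ : S.IsPoint P γ) {i : S.fixed P} (hi : i ∈ γ) :
    IsPrimitiveIdempotent i := by
  obtain ⟨e, he, rfl⟩ := hγ
  obtain ⟨a, rfl⟩ := hi
  exact he.conj a

theorem IsPoint.mem_iff (hγ : S.IsPoint P γ) {i : S.fixed P} (hi : i ∈ γ) {j : S.fixed P} :
    j ∈ γ ↔ ∃ a : (S.fixed P)ˣ, j = a * i * ((a⁻¹ : (S.fixed P)ˣ) : S.fixed P) := by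
  obtain ⟨e, he, rfl⟩ := hγ
  obtain ⟨c, rfl⟩ := hi
  constructor
  · rintro ⟨a, rfl⟩
    exact ⟨a * c⁻¹, by simp [mul_assoc]⟩
  · rintro ⟨a, rfl⟩
    exact ⟨a * c, by simp [mul_assoc]⟩

theorem conj_mul_distrib (g : G) (a c : A) : S.conj g (a * c) = S.conj g a * S.conj g c := by
  calc S.conj g (a * c) = S.σ g * a * 1 * c * S.σ g⁻¹ := by simp [conj, mul_assoc]
    _ = _ := by rw [← S.σ_inv_mul g]; simp [conj, mul_assoc]

theorem conj_mem_comp {g : G} {a : A} {x : G ⧸ H} (ha : a ∈ S.comp x) :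
    S.conj g a ∈ S.comp (g * x * (g : G ⧸ H)⁻¹) :=
  S.mul_mem (S.mul_mem (S.σ_mem g) ha) (S.σ_mem g⁻¹)

theorem conj_mem_fixed {g : G} (hg : g ∈ Subgroup.normalizer (P : Set G)) {a : A}
    (ha : a ∈ S.fixed P) : S.conj g a ∈ S.fixed P := by
  refine ⟨by simpa using conj_mem_comp (g := g) ha.1, fun u hu => ?_⟩
  have hu' : g⁻¹ * u * g ∈ P := by
    simpa using (Subgroup.mem_normalizer_iff.1 (inv_mem hg) u).1 hu
  have h := ha.2 _ hu'
  conv_rhs => rw [← h]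
  rw [← conj_mul, ← conj_mul]
  congr 1
  group

/-- Conjugation by an element of `N_G(P)` on `B^P`. -/
def fixedConj {g : G} (hg : g ∈ Subgroup.normalizer (P : Set G)) : S.fixed P →* S.fixed P where
  toFun a := ⟨S.conj g a, conj_mem_fixed hg a.2⟩
  map_one' := Subtype.ext (by simp [conj, S.σ_mul_inv])
  map_mul' a c := Subtype.ext (conj_mul_distrib g _ _)

/-- Conjugation by `g` permutes the `(B^P)ˣ`-conjugacy classes, so `γ` is stable as soon as one of
its elements stays in it. -/
theorem IsPoint.mem_pointNormalizer (hγ : S.IsPoint P γ) {i : S.fixed P} (hi : i ∈ γ) {g : G}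
    (hg : g ∈ Subgroup.normalizer (P : Set G)) (h : fixedConj hg i ∈ γ) :
    g ∈ S.pointNormalizer P γ := by
  have key : ∀ {g : G} (hg : g ∈ Subgroup.normalizer (P : Set G)), fixedConj hg i ∈ γ →
      ∀ j ∈ γ, fixedConj hg j ∈ γ := by
    intro g hg h j hj
    obtain ⟨a, rfl⟩ := (hγ.mem_iff hi).1 hj
    refine (hγ.mem_iff h).2 ⟨Units.map (fixedConj hg) a, ?_⟩
    rw [map_mul, map_mul, ← map_inv, Units.coe_map, Units.coe_map]
  -- Equality of sets also needs stability under `g⁻¹`: apply `g⁻¹` to `ᵍi = ᵃi` and solve for the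
  -- conjugate of `i`.
  have hinv : fixedConj (inv_mem hg) i ∈ γ := by
    obtain ⟨a, ha⟩ := (hγ.mem_iff hi).1 h
    have h1 : ∀ j : S.fixed P, fixedConj (inv_mem hg) (fixedConj hg j) = j := fun j =>
      Subtype.ext (by
        change S.conj g⁻¹ (S.conj g j) = j
        rw [← conj_mul, inv_mul_cancel, conj_one])
    refine (hγ.mem_iff hi).2 ⟨(Units.map (fixedConj (inv_mem hg)) a)⁻¹, ?_⟩
    have h2 := congrArg (fixedConj (inv_mem hg)) ha
    rw [h1, map_mul, map_mul] at h2
    rw [inv_inv, ← map_inv, Units.coe_map, Units.coe_map]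
    conv_rhs => rw [h2]
    simp only [← mul_assoc, ← map_mul]
    simp
  refine ⟨hg, Set.Subset.antisymm ?_ ?_⟩
  · rintro _ ⟨_, ⟨j, hj, rfl⟩, rfl⟩
    exact ⟨_, key hg h j hj, rfl⟩
  · rintro _ ⟨j, hj, rfl⟩
    refine ⟨_, ⟨_, key (inv_mem hg) hinv j hj, rfl⟩, ?_⟩
    change S.conj g (S.conj g⁻¹ j) = j
    rw [← conj_mul, mul_inv_cancel, conj_one]

variable (S) in
/-- The action of `N_G(P_γ)` on `P`. -/
def pointAut (γ : Set (S.fixed P)) : S.pointNormalizer P γ →* MulAut P :=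
  P.normalizerMonoidHom.comp (Subgroup.inclusion fun _ hg => hg.1)

theorem coe_pointAut (g : S.pointNormalizer P γ) (u : P) :
    ((S.pointAut γ g u : P) : G) = g * u * (g : G)⁻¹ := rfl

section Normalizer

variable {i : S.fixed P} (hi : IsIdempotentElem (i : A))

/-- An element `g` of `N_G(P_γ)`, with `ᵍi = ᵃi`, yields the element `i a⁻¹ g` of
`N_{hU(iAi)}(Pi)`. -/
theorem exists_hUNormalizer (g : S.pointNormalizer P γ) (a : (S.fixed P)ˣ)
    (h : S.conj g (i : A) =
      ((a : S.fixed P) * i * (a⁻¹ : (S.fixed P)ˣ) : S.fixed P)) :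
    ∃ n : S.hUNormalizer i hi,
      n.1.1.1 = (i : A) * ((a⁻¹ : (S.fixed P)ˣ) : S.fixed P) * S.σ g ∧
      (∀ u, S.cornerMap i hi (S.pointAut γ g u) = n.1 * S.cornerMap i hi u * n.1⁻¹) ∧
      n.1.1.1 ∈ S.comp ((g : G) : G ⧸ H) := by
  set c : A := ((a : S.fixed P) : A)
  set d : A := (((a⁻¹ : (S.fixed P)ˣ) : S.fixed P) : A)
  have hdc : d * c = 1 := congrArg Subtype.val a.inv_mul
  replace h : S.σ g * i * S.σ (g : G)⁻¹ = c * i * d := h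
  have hgg := S.σ_mul_inv (g : G)
  have hgg' := S.σ_inv_mul (g : G)
  have hgi : S.σ g * i = c * i * d * S.σ g := by rw [← h, mul_assoc, hgg', mul_one]
  have hig : i * S.σ (g : G)⁻¹ = S.σ (g : G)⁻¹ * (c * i * d) := by
    rw [← h, ← mul_assoc, ← mul_assoc, hgg', one_mul]
  -- The unit `a⁻¹g` of `A` commutes with `i`; hence `i a⁻¹ g` is a unit of `iAi`, with inverse `g⁻¹
  -- a i`. It induces `c_g` on `Pi` because `a⁻¹` commutes with `P`.
  have h1 : i * d * S.σ g = d * S.σ g * i := by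
    rw [mul_assoc, mul_assoc, hgi]
    simp only [← mul_assoc]
    rw [hdc, one_mul]
  have h2 : S.σ (g : G)⁻¹ * c * i = i * S.σ (g : G)⁻¹ * c := by
    rw [hig]
    simp only [mul_assoc]
    rw [hdc, mul_one]
  have hnm : i * d * S.σ g * (S.σ (g : G)⁻¹ * c * i) = i := by
    calc _ = i * d * (S.σ g * S.σ (g : G)⁻¹) * c * i := by simp only [mul_assoc]
      _ = i * (d * c) * i := by rw [hgg]; simp only [mul_assoc, one_mul]
      _ = i := by rw [hdc, mul_one, hi.eq]
  have hmn : S.σ (g : G)⁻¹ * c * i * (i * d * S.σ g) = i := by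
    calc _ = S.σ (g : G)⁻¹ * (c * (i * i) * d) * S.σ g := by simp only [mul_assoc]
      _ = i * (S.σ (g : G)⁻¹ * S.σ g) := by rw [hi.eq, ← hig, mul_assoc]
      _ = i := by rw [hgg', mul_one]
  let n : (hi.Corner)ˣ :=
    { val := ⟨i * d * S.σ g, (Subsemigroup.mem_corner_iff hi).2
        ⟨by rw [← mul_assoc, ← mul_assoc, hi.eq], by
          rw [h1, mul_assoc, hi.eq]⟩⟩
      inv := ⟨S.σ (g : G)⁻¹ * c * i, (Subsemigroup.mem_corner_iff hi).2
        ⟨by rw [h2, ← mul_assoc, ← mul_assoc, hi.eq], by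
          rw [mul_assoc, hi.eq]⟩⟩
      val_inv := Subtype.ext hnm
      inv_val := Subtype.ext hmn }
  have hdeg : n.1 ∈ (S.cornerGrading i hi).comp ((g : G) : G ⧸ H) := by
    change i * d * S.σ g ∈ S.comp _
    simpa using S.mul_mem (S.mul_mem i.2.1 (a⁻¹ : (S.fixed P)ˣ).1.2.1) (S.σ_mem g)
  have hu (u : P) : S.cornerMap i hi (S.pointAut γ g u) * n = n * S.cornerMap i hi u := by
    refine Units.ext (Subtype.ext ?_)
    change (S.cornerMap i hi (S.pointAut γ g u)).1.1 * (i * d * S.σ g) =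
      i * d * S.σ g * (S.cornerMap i hi u).1.1
    rw [coe_cornerMap_eq_mul', coe_cornerMap_eq_mul, coe_pointAut]
    have h3 : S.σ (S.pointAut γ g u) * d = d * S.σ (S.pointAut γ g u) :=
      S.fixed_comm ((a⁻¹ : (S.fixed P)ˣ) : S.fixed P) (S.pointAut γ g u).2
    have h4 := S.fixed_comm i (S.pointAut γ g u).2
    rw [coe_pointAut] at h3 h4
    calc S.σ (g * u * (g : G)⁻¹) * i * (i * d * S.σ g)
        = S.σ (g * u * (g : G)⁻¹) * (i * i) * d * S.σ g := by simp only [mul_assoc]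
      _ = i * (S.σ (g * u * (g : G)⁻¹) * d) * S.σ g := by rw [hi.eq, h4]; simp only [mul_assoc]
      _ = i * d * (S.σ (g * u * (g : G)⁻¹) * S.σ g) := by rw [h3]; simp only [mul_assoc]
      _ = i * d * (S.σ g * S.σ u) := by
        rw [← map_mul, ← map_mul, inv_mul_cancel_right]
      _ = i * d * S.σ g * i * S.σ u := by
        rw [h1, mul_assoc _ (i : A) i, hi.eq, ← h1]; simp only [mul_assoc]
      _ = _ := by simp only [mul_assoc]
  replace hu (u : P) : S.cornerMap i hi (S.pointAut γ g u) = n * S.cornerMap i hi u * n⁻¹ :=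
    eq_mul_inv_iff_mul_eq.2 (hu u)
  have hnorm : n ∈ S.hUNormalizer i hi := by
    refine ⟨⟨_, hdeg⟩, Subgroup.mem_normalizer_iff.2 fun c => ?_⟩
    constructor
    · rintro ⟨u, rfl⟩
      exact ⟨_, hu u⟩
    · rintro ⟨u, hu'⟩
      refine ⟨(S.pointAut γ g)⁻¹ u, ?_⟩
      have := hu ((S.pointAut γ g)⁻¹ u)
      rw [MulAut.apply_inv_self, hu'] at this
      simpa using this.symm
  exact ⟨⟨n, hnorm⟩, rfl, hu, hdeg⟩

theorem IsPoint.exists_conj_eq (hγ : S.IsPoint P γ) (hiγ : i ∈ γ) (g : S.pointNormalizer P γ) :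
    ∃ a : (S.fixed P)ˣ, S.conj g (i : A) =
      ((a : S.fixed P) * i * (a⁻¹ : (S.fixed P)ˣ) : S.fixed P) := by
  obtain ⟨j, hj, hji⟩ := g.2.2 ▸ Set.mem_image_of_mem (S.conj g) (Set.mem_image_of_mem _ hiγ)
  obtain ⟨a, rfl⟩ := (hγ.mem_iff hiγ).1 hj
  exact ⟨a, hji.symm⟩

/-- The map from `N_G(P_γ)` to the group of `(A, Ḡ)`-fusions, which sends `g` to `(c_g, ḡ)`. -/
def pointHom (hγ : S.IsPoint P γ) (hiγ : i ∈ γ) : S.pointNormalizer P γ →* S.F i :=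
  (((S.pointAut γ).prod ((QuotientGroup.mk' H).comp (S.pointNormalizer P γ).subtype)).codRestrict
    (autBar H P) fun _ _ => rfl).codRestrict (S.F i) fun g => by
    obtain ⟨a, ha⟩ := hγ.exists_conj_eq hiγ g
    obtain ⟨n, -, hn, hn'⟩ := exists_hUNormalizer (hγ.isIdempotentElem hiγ) g a ha
    exact ⟨_, S.isFusionIso_bimodMulInv i (hγ.isIdempotentElem hiγ) hn hn'⟩

theorem ker_pointHom (hγ : S.IsPoint P γ) (hiγ : i ∈ γ) :
    (pointHom hγ hiγ).ker = S.pointCentralizer P γ := by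
  ext g
  have h1 : g ∈ (pointHom hγ hiγ).ker ↔ S.pointAut γ g = 1 ∧ ((g : G) : G ⧸ H) = 1 := by
    rw [MonoidHom.mem_ker, Subtype.ext_iff, Subtype.ext_iff, Prod.ext_iff]
    rfl
  rw [h1, QuotientGroup.eq_one_iff, and_comm]
  refine and_congr_right fun _ => ?_
  refine Iff.trans ?_ Subgroup.mem_centralizer_iff.symm
  rw [MulEquiv.ext_iff]
  constructor
  · intro h u hu
    have := congrArg Subtype.val (h ⟨u, hu⟩)
    rw [coe_pointAut] at this
    exact (mul_inv_eq_iff_eq_mul.1 this).symm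
  · intro h u
    refine Subtype.ext ?_
    rw [coe_pointAut]
    exact mul_inv_eq_iff_eq_mul.2 (h u u.2).symm

/-- The isomorphism from `N_G(P_γ)/C_H(P)` to the group of `(A, Ḡ)`-fusions. -/
def pointEquiv (hγ : S.IsPoint P γ) (hiγ : i ∈ γ)
    (hsurj : Function.Surjective (pointHom hγ hiγ)) : S.E P γ ≃* S.F i :=
  (QuotientGroup.quotientMulEquivOfEq (ker_pointHom hγ hiγ).symm).trans
    (QuotientGroup.quotientKerEquivOfSurjective _ hsurj)

theorem pointEquiv_mk (hγ : S.IsPoint P γ) (hiγ : i ∈ γ)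
    (hsurj : Function.Surjective (pointHom hγ hiγ)) (g : S.pointNormalizer P γ) :
    pointEquiv hγ hiγ hsurj (QuotientGroup.mk g) = pointHom hγ hiγ g := rfl

/-- The isomorphisms between the fusion groups of `P_γ`, if `u ↦ ui` is injective on `P` and every
`(A, Ḡ)`-fusion is a `(G, Ḡ)`-fusion. -/
theorem exists_fusion_equivs (hγ : S.IsPoint P γ) (hiγ : i ∈ γ)
    [Nontrivial (hγ.isIdempotentElem hiγ).Corner]
    (hinj : Function.Injective (S.cornerMap i (hγ.isIdempotentElem hiγ)))
    (hsurj : Function.Surjective (pointHom hγ hiγ)) :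
    ∃ (e₁ : S.E P γ ≃* S.NmodC i (hγ.isIdempotentElem hiγ))
      (e₂ : S.NmodC i (hγ.isIdempotentElem hiγ) ≃* S.F i),
      (∀ (g : S.pointNormalizer P γ) (a : (S.fixed P)ˣ),
        S.conj g (i : A) = ((a : S.fixed P) * i * (a⁻¹ : (S.fixed P)ˣ) : S.fixed P) →
          ∃ n : S.hUNormalizer i (hγ.isIdempotentElem hiγ),
            n.1.1.1 = (i : A) * ((a⁻¹ : (S.fixed P)ˣ) : S.fixed P) * S.σ g ∧
            e₁ (QuotientGroup.mk g) = QuotientGroup.mk n) ∧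
      (∀ n : S.hUNormalizer i (hγ.isIdempotentElem hiγ),
        (∀ u : P, S.cornerMap i (hγ.isIdempotentElem hiγ)
            ((e₂ (QuotientGroup.mk n)).1.1.1 u) =
          n.1 * S.cornerMap i (hγ.isIdempotentElem hiγ) u * n.1⁻¹) ∧
        n.1.1.1 ∈ S.comp (e₂ (QuotientGroup.mk n)).1.1.2) ∧
      (∀ g : S.pointNormalizer P γ,
        (∀ u : P, (((e₂ (e₁ (QuotientGroup.mk g))).1.1.1 u : P) : G) = g * u * (g : G)⁻¹) ∧
        (e₂ (e₁ (QuotientGroup.mk g))).1.1.2 = ((g : G) : G ⧸ H)) := by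
  have hi := hγ.isIdempotentElem hiγ
  -- The first isomorphism is defined through `F`, so independence of `a` and multiplicativity are
  -- automatic; its formula holds because `i a⁻¹ g` and `g` have the same image in `F`.
  let e₂ := S.fusionEquiv i hi hinj
  let e := pointEquiv hγ hiγ hsurj
  have he (g : S.pointNormalizer P γ) :
      e₂ ((e.trans e₂.symm) (QuotientGroup.mk g)) = pointHom hγ hiγ g := by
    rw [MulEquiv.trans_apply, MulEquiv.apply_symm_apply, pointEquiv_mk]
  refine ⟨e.trans e₂.symm, e₂, fun g a ha => ?_, fun n => ?_, fun g => ?_⟩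
  · obtain ⟨n, hn, hn', hdeg⟩ := exists_hUNormalizer hi g a ha
    refine ⟨n, hn, e₂.injective ?_⟩
    rw [he, fusionEquiv_mk]
    exact (S.fusionHom_eq i hi hinj hn' hdeg).symm
  · rw [fusionEquiv_mk]
    exact ⟨S.cornerMap_fusionHom i hi hinj n, S.mem_comp_fusionHom i hi hinj n⟩
  · rw [he]
    exact ⟨fun u => rfl, rfl⟩

theorem σ_mul_coe_unit {n : (hi.Corner)ˣ} {u v : P}
    (h : S.cornerMap i hi u * n = n * S.cornerMap i hi v) :
    S.σ u * n.1.1 = n.1.1 * S.σ v := by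
  have hval : (S.cornerMap i hi u).1.1 * n.1.1 = n.1.1 * (S.cornerMap i hi v).1.1 :=
    congrArg (fun c : (hi.Corner)ˣ => c.1.1) h
  rwa [coe_cornerMap_eq_mul', coe_cornerMap_eq_mul, mul_assoc, corner_mul_left, ← mul_assoc,
    corner_mul_right] at hval

/-- If the fusion of `P` given by `n` is the conjugation by `x ∈ G`, then `x` normalizes `P_γ`. -/
theorem IsPoint.mem_pointNormalizer_of_hUNormalizer [IsLocalRing O] [IsNoetherianRing O]
    [IsAdicComplete (IsLocalRing.maximalIdeal O) O] [Module.Finite O (S.fixed P)]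
    (hγ : S.IsPoint P γ) (hiγ : i ∈ γ) {n : (hi.Corner)ˣ} {x : G} {φ : MulAut P}
    (hn : n.1.1 ∈ S.comp (x : G ⧸ H))
    (hφ : ∀ u, S.cornerMap i hi (φ u) = n * S.cornerMap i hi u * n⁻¹)
    (hx : ∀ u : P, (φ u : G) * x = x * u) : x ∈ S.pointNormalizer P γ := by
  have hxP : x ∈ Subgroup.normalizer (P : Set G) := by
    refine Subgroup.mem_normalizer_iff.2 fun u => ⟨fun hu => ?_, fun hu => ?_⟩
    · rw [← hx ⟨u, hu⟩, mul_inv_cancel_right]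
      exact (φ ⟨u, hu⟩).2
    · have h := hx (φ⁻¹ ⟨_, hu⟩)
      rw [MulAut.apply_inv_self] at h
      have h' : x * u = x * (φ⁻¹ ⟨_, hu⟩ : P) := by simpa using h
      rw [mul_left_cancel h']
      exact (φ⁻¹ ⟨_, hu⟩ : P).2
  refine hγ.mem_pointNormalizer hiγ hxP ((hγ.mem_iff hiγ).2 ?_)
  have hu1 (u : P) : S.σ (φ u) * n.1.1 = n.1.1 * S.σ u :=
    σ_mul_coe_unit hi (by rw [hφ]; group)
  have hu2 (u : P) : S.σ u * n⁻¹.1.1 = n⁻¹.1.1 * S.σ (φ u) :=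
    σ_mul_coe_unit hi (by rw [hφ]; group)
  have hninv : n⁻¹.1.1 ∈ S.comp (x : G ⧸ H)⁻¹ :=
    (S.cornerGrading i hi).inv_mem n (show n.1 ∈ (S.cornerGrading i hi).comp _ from hn)
  -- The elements `c = n x⁻¹` and `d = x n⁻¹` have degree `1`, and they are `P`-fixed because `n`
  -- and `x` induce the same automorphism of `P`. They satisfy `cd = i` and `dc = ˣi`.
  let c : S.fixed P := ⟨n.1.1 * S.σ x⁻¹, by simpa using S.mul_mem hn (S.σ_mem x⁻¹), by
    intro u hu
    obtain ⟨u, rfl⟩ : ∃ v : P, (φ v : G) = u := ⟨φ⁻¹ ⟨u, hu⟩, by simp⟩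
    have h : (u : G) * x⁻¹ = x⁻¹ * φ u := by
      rw [mul_inv_eq_iff_eq_mul, mul_assoc, hx, inv_mul_cancel_left]
    rw [conj, ← mul_assoc, hu1, mul_assoc _ (S.σ u), ← map_mul, h, map_mul, mul_assoc, mul_assoc,
      σ_mul_inv, mul_one]⟩
  let d : S.fixed P := ⟨S.σ x * n⁻¹.1.1, by simpa using S.mul_mem (S.σ_mem x) hninv, by
    intro u hu
    obtain ⟨u, rfl⟩ : ∃ v : P, (φ v : G) = u := ⟨φ⁻¹ ⟨u, hu⟩, by simp⟩
    rw [conj, ← mul_assoc, ← map_mul, hx, map_mul, mul_assoc _ (S.σ u), hu2, mul_assoc, mul_assoc,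
      σ_mul_inv, mul_one]⟩
  have hnn : n.1.1 * n⁻¹.1.1 = i := congrArg Subtype.val n.mul_inv
  have hnn' : n⁻¹.1.1 * n.1.1 = i := congrArg Subtype.val n.inv_mul
  have hxx := S.σ_inv_mul x
  obtain ⟨a, ha⟩ : IsConj i (fixedConj hxP i) := by
    refine IsPrimitiveIdempotent.isConj (O := O) (c := c) (d := d)
      (hγ.isPrimitiveIdempotent hiγ) (Subtype.ext ?_) (Subtype.ext ?_) (Subtype.ext ?_)
      (Subtype.ext ?_) (Subtype.ext ?_) (Subtype.ext ?_)
    · change i * (n.1.1 * S.σ x⁻¹) = n.1.1 * S.σ x⁻¹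
      rw [← mul_assoc, corner_mul_left]
    · change n.1.1 * S.σ x⁻¹ * (S.σ x * i * S.σ x⁻¹) = n.1.1 * S.σ x⁻¹
      rw [← mul_assoc, ← mul_assoc, mul_assoc n.1.1, hxx, mul_one, corner_mul_right]
    · change S.σ x * i * S.σ x⁻¹ * (S.σ x * n⁻¹.1.1) = S.σ x * n⁻¹.1.1
      rw [← mul_assoc, mul_assoc _ (S.σ x⁻¹), hxx, mul_one, mul_assoc, corner_mul_left]
    · change S.σ x * n⁻¹.1.1 * i = S.σ x * n⁻¹.1.1
      rw [mul_assoc, corner_mul_right]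
    · change n.1.1 * S.σ x⁻¹ * (S.σ x * n⁻¹.1.1) = i
      rw [← mul_assoc, mul_assoc n.1.1, hxx, mul_one, hnn]
    · change S.σ x * n⁻¹.1.1 * (n.1.1 * S.σ x⁻¹) = S.σ x * i * S.σ x⁻¹
      rw [← mul_assoc, mul_assoc (S.σ x), hnn']
  exact ⟨a, a.eq_mul_inv_iff_mul_eq.2 ha.eq.symm⟩

end Normalizer

end InteriorAlgebra

/-! ### The Brauer kernel and sums over `P`-sets. -/

section Brauer

namespace InteriorAlgebra

variable {O G A : Type*} [CommRing O] [Group G] {H : Subgroup G} [H.Normal] [Ring A] [Algebra O A]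
variable {S : InteriorAlgebra O A H} {P : Subgroup G}

theorem fixed_anti {Q : Subgroup G} (h : Q ≤ P) : S.fixed P ≤ S.fixed Q :=
  fun _ ha => ⟨ha.1, fun u hu => ha.2 u (h hu)⟩

theorem relTrace_mul_mul [Finite G] {Q : Subgroup G} (x : A) {a c : A} (ha : a ∈ S.fixed P)
    (hc : c ∈ S.fixed P) : a * S.relTrace Q P x * c = S.relTrace Q P (a * x * c) := by
  have := Fintype.ofFinite (P ⧸ Q.subgroupOf P)
  simp only [relTrace, finsum_eq_sum_of_fintype, Finset.mul_sum, Finset.sum_mul]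
  refine Finset.sum_congr rfl fun y _ => ?_
  rw [conj_mul_distrib, conj_mul_distrib, ha.2 _ (Quotient.out y).2, hc.2 _ (Quotient.out y).2]

/-- Elements of `B^P` can be moved inside a relative trace, which makes the kernel a two-sided ideal
of `B^P`. -/
theorem mul_mem_brauerKernel [Finite G] [IsLocalRing O] {a c t : A} (ha : a ∈ S.fixed P)
    (hc : c ∈ S.fixed P) (ht : t ∈ S.brauerKernel P) : a * t * c ∈ S.brauerKernel P := by
  let f : A →ₗ[O] A := LinearMap.mulRight O c ∘ₗ LinearMap.mulLeft O a
  suffices h : S.brauerKernel P ≤ (S.brauerKernel P).comap f from h ht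
  refine sup_le (Submodule.span_le.2 ?_) (Submodule.smul_le.2 fun r hr y hy => ?_)
  · rintro _ ⟨Q, hQ, y, hy, rfl⟩
    refine Submodule.mem_sup_left (Submodule.subset_span ⟨Q, hQ, a * y * c, ?_,
      relTrace_mul_mul y ha hc⟩)
    exact mul_mem (mul_mem (fixed_anti hQ.le ha) hy) (fixed_anti hQ.le hc)
  · refine Submodule.mem_sup_right ?_
    change a * (r • y) * c ∈ _
    rw [mul_smul_comm, smul_mul_assoc]
    exact Submodule.smul_mem_smul hr ((S.fixed P).mul_mem ((S.fixed P).mul_mem ha hy) hc)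

/-- Locality is assumed for one element of `γ`; the ideal property transfers it to all conjugates.
-/
theorem IsLocalPoint.notMem_brauerKernel [Finite G] [IsLocalRing O] {γ : Set (S.fixed P)}
    (hγ : S.IsLocalPoint P γ) {i : S.fixed P} (hi : i ∈ γ) : (i : A) ∉ S.brauerKernel P := by
  obtain ⟨hγ, j, hj, hj'⟩ := hγ
  obtain ⟨a, rfl⟩ := (hγ.mem_iff hi).1 hj
  exact fun h => hj' (mul_mem_brauerKernel a.1.2 (a⁻¹).1.2 h)

/-- The sum over a `P`-set without relevant fixed points of a `P`-equivariant family of elements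
of `B` is in the kernel of the Brauer homomorphism. -/
theorem sum_mem_brauerKernel [Finite G] [IsLocalRing O] {X : Type*} [Fintype X] [MulAction P X]
    (F : X → A) (hF : ∀ (u : P) x, F (u • x) = S.conj u (F x))
    (h : ∀ x, F x ≠ 0 → F x ∈ S.comp 1 ∧ MulAction.stabilizer P x ≠ ⊤) :
    ∑ x, F x ∈ S.brauerKernel P := by
  classical
  have (K : Subgroup P) : Fintype (P ⧸ K) := Fintype.ofFinite _
  have : Fintype (MulAction.orbitRel.Quotient P X) := Fintype.ofFinite _
  -- Orbit by orbit, the sum is the relative trace of the value at a representative from its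
  -- stabilizer, a proper subgroup wherever that value is nonzero.
  rw [← (MulAction.selfEquivSigmaOrbitsQuotientStabilizer P X).symm.sum_comp, Fintype.sum_sigma]
  refine Submodule.sum_mem _ fun ω _ => ?_
  set x : X := ω.out
  have hsum : ∑ y : P ⧸ MulAction.stabilizer P x,
      F ((MulAction.selfEquivSigmaOrbitsQuotientStabilizer P X).symm ⟨ω, y⟩) =
      ∑ y : P ⧸ MulAction.stabilizer P x, S.conj ((Quotient.out y : P) : G) (F x) := by
    refine Finset.sum_congr rfl fun y _ => ?_
    rw [← hF]
    congr 1
    nth_rw 1 [← QuotientGroup.out_eq' y]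
    rfl
  rw [hsum]
  by_cases h0 : F x = 0
  · refine Submodule.sum_mem _ fun y _ => ?_
    rw [h0]
    simp [conj]
  · obtain ⟨h1, h2⟩ := h x h0
    refine Submodule.mem_sup_left (Submodule.subset_span
      ⟨(MulAction.stabilizer P x).map P.subtype, ?_, F x, ⟨h1, ?_⟩, ?_⟩)
    · refine lt_of_le_of_ne (Subgroup.map_subtype_le _) fun h => h2 ?_
      rw [eq_top_iff]
      intro u _
      have hu : (u : G) ∈ (MulAction.stabilizer P x).map P.subtype := by rw [h]; exact u.2
      obtain ⟨v, hv, hvu⟩ := hu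
      rwa [← Subtype.ext hvu]
    · rintro _ ⟨v, hv, rfl⟩
      have := hF v x
      rw [MulAction.mem_stabilizer_iff.1 hv] at this
      exact this.symm
    · have hK : ((MulAction.stabilizer P x).map P.subtype).subgroupOf P =
          MulAction.stabilizer P x :=
        Subgroup.comap_map_eq_self_of_injective P.subtype_injective _
      rw [relTrace, hK, finsum_eq_sum_of_fintype]

end InteriorAlgebra

/-- The action of `P` on `G` by left multiplication and `φ⁻¹`-twisted right multiplication. -/
abbrev twistedAction {G : Type*} [Group G] {P : Subgroup G} (φ : MulAut P) : MulAction P G where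
  smul u x := u * x * ((φ⁻¹ u : P) : G)⁻¹
  one_smul x := by
    change ((1 : P) : G) * x * ((φ⁻¹ 1 : P) : G)⁻¹ = x
    simp
  mul_smul u v x := by
    change ((u * v : P) : G) * x * ((φ⁻¹ (u * v) : P) : G)⁻¹ =
      u * (v * x * ((φ⁻¹ v : P) : G)⁻¹) * ((φ⁻¹ u : P) : G)⁻¹
    simp [mul_assoc]

end Brauer

/-! ### Faithfulness of the action of a `p`-group on a nonzero idempotent. -/

section Faithful

theorem sum_eq_card_nsmul_of_forall_mul_right {G M : Type*} [Group G] [Fintype G]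
    [AddCommMonoid M] (K : Subgroup G) (F : G → M) (hF : ∀ g, ∀ k ∈ K, F (g * k) = F g) :
    ∃ y, ∑ g, F g = Nat.card K • y := by
  classical
  have : Fintype (G ⧸ K) := Fintype.ofFinite _
  have : Fintype K := Fintype.ofFinite _
  refine ⟨∑ c : G ⧸ K, F c.out, ?_⟩
  have hbij : Function.Bijective fun x : (G ⧸ K) × K => x.1.out * (x.2 : G) := by
    have hmk (x : (G ⧸ K) × K) : ((x.1.out * (x.2 : G) : G) : G ⧸ K) = x.1 := by
      rw [QuotientGroup.mk_mul_of_mem _ x.2.2, QuotientGroup.out_eq']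
    refine ⟨fun x y h => ?_, fun g => ?_⟩
    · have h1 : x.1 = y.1 := by rw [← hmk x, ← hmk y]; exact congrArg _ h
      refine Prod.ext h1 (Subtype.ext ?_)
      dsimp only at h
      rwa [h1, mul_right_inj] at h
    · exact ⟨⟨g, ⟨_, QuotientGroup.eq.1 (QuotientGroup.out_eq' (g : G ⧸ K))⟩⟩, by simp⟩
  rw [← hbij.sum_comp, Fintype.sum_prod_type, Finset.smul_sum]
  refine Finset.sum_congr rfl fun c _ => ?_
  rw [Nat.card_eq_fintype_card, ← Finset.card_univ, ← Finset.sum_const]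
  exact Finset.sum_congr rfl fun k _ => hF _ _ k.2

/-- Nakayama's lemma for the left ideal `Rj`: the relation gives `aj = r(azj)`, so `Rj` is contained
in its product with the maximal ideal. -/
theorem eq_zero_of_eq_smul_mul {O R : Type*} [CommRing O] [IsLocalRing O] [IsNoetherianRing O]
    [Ring R] [Algebra O R] [Module.Finite O R] {j z : R} {r : O}
    (hr : r ∈ IsLocalRing.maximalIdeal O) (h : j = r • (z * j)) : j = 0 := by
  have hN : LinearMap.range (LinearMap.mulRight O j) = ⊥ := by
    refine Submodule.eq_bot_of_le_smul_of_le_jacobson_bot (IsLocalRing.maximalIdeal O) _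
      (IsNoetherian.noetherian _) ?_ (IsLocalRing.maximalIdeal_le_jacobson _)
    rintro _ ⟨a, rfl⟩
    change a * j ∈ _
    have ha : a * j = r • (a * z * j) := by
      conv_lhs => rw [h]
      rw [mul_smul_comm, ← mul_assoc]
    rw [ha]
    exact Submodule.smul_mem_smul hr ⟨a * z, rfl⟩
  have : j ∈ LinearMap.range (LinearMap.mulRight O j) := ⟨1, one_mul j⟩
  simpa [hN] using this

theorem sum_coeff_smul_of {O G : Type*} [CommRing O] [Group G] [Fintype G]
    (a : MonoidAlgebra O G) : ∑ g, a.coeff g • MonoidAlgebra.of O G g = a := by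
  conv_rhs => rw [← MonoidAlgebra.sum_coeff_single a]
  rw [Finsupp.sum_fintype _ _ (by simp)]
  simp

/-- An idempotent of the group algebra on which `u` acts trivially is zero, if the order of `u` is
not invertible. -/
theorem eq_zero_of_of_mul_eq {O G : Type*} [CommRing O] [IsLocalRing O] [IsNoetherianRing O]
    [Group G] [Finite G] {j : MonoidAlgebra O G} (hj : j * j = j) {u : G}
    (hju : j * MonoidAlgebra.of O G u = j) (huj : MonoidAlgebra.of O G u * j = j)
    (hu : (orderOf u : O) ∈ IsLocalRing.maximalIdeal O) : j = 0 := by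
  have := Fintype.ofFinite G
  -- In `j = j * j = ∑ j_g g j` the summands are constant on the cosets `g⟨u⟩`: `ju = j` controls
  -- the coefficients and `uj = j` the factors `g j`. Hence `j` is a multiple of the order of `u`.
  have hinv : ∀ g, ∀ k ∈ Subgroup.zpowers u,
      j.coeff (g * k) • MonoidAlgebra.of O G (g * k) * j =
        j.coeff g • MonoidAlgebra.of O G g * j := by
    intro g k hk
    obtain ⟨n, rfl⟩ := mem_powers_iff_mem_zpowers.2 hk
    clear hk
    dsimp only
    have h1 : j * MonoidAlgebra.of O G (u ^ n) = j := by
      induction n with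
      | zero => rw [pow_zero, map_one, mul_one]
      | succ n ih => rw [pow_succ, map_mul, ← mul_assoc, ih, hju]
    have h2 : MonoidAlgebra.of O G (u ^ n) * j = j := by
      clear h1
      induction n with
      | zero => rw [pow_zero, map_one, one_mul]
      | succ n ih => rw [pow_succ, map_mul, mul_assoc, huj, ih]
    have h3 : j.coeff (g * u ^ n) = j.coeff g := by
      conv_lhs => rw [← h1]
      simp
    rw [h3, map_mul, smul_mul_assoc, mul_assoc, h2, smul_mul_assoc]
  obtain ⟨y, hy⟩ := sum_eq_card_nsmul_of_forall_mul_right (Subgroup.zpowers u)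
    (fun g => j.coeff g • MonoidAlgebra.of O G g * j) hinv
  rw [← Finset.sum_mul, sum_coeff_smul_of, hj, Nat.card_zpowers] at hy
  refine eq_zero_of_eq_smul_mul (O := O) (z := y) hu ?_
  rw [Nat.cast_smul_eq_nsmul, ← smul_mul_assoc, ← hy, hj]

end Faithful

/-! ### Block extensions: injectivity of `u ↦ ui`, and fusions realized in `G`. -/

namespace InvariantBlock

variable {O G : Type*} [CommRing O] [Group G] {H : Subgroup G} [H.Normal] (b : InvariantBlock O H)

theorem coe_σ_mul (g : G) (a : b.A) :
    (b.extension.σ g * a).1 = MonoidAlgebra.of O G g * a.1 := by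
  change b.idem * MonoidAlgebra.of O G g * b.idem * a.1 = _
  rw [← b.of_mul_idem, mul_assoc, mul_assoc, corner_mul_left, corner_mul_left]

theorem coe_mul_σ (g : G) (a : b.A) :
    (a * b.extension.σ g).1 = a.1 * MonoidAlgebra.of O G g := by
  change a.1 * (b.idem * MonoidAlgebra.of O G g * b.idem) = _
  rw [mul_assoc b.idem, b.of_mul_idem, ← mul_assoc, ← mul_assoc, corner_mul_right,
    corner_mul_right]

theorem sum_coeff_smul_σ [Fintype G] (a : b.A) :
    ∑ g, a.1.coeff g • b.extension.σ g = a := by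
  refine Subtype.ext ?_
  change cornerIncl O b.isIdempotentElem_idem _ = _
  rw [map_sum]
  calc ∑ g, cornerIncl O b.isIdempotentElem_idem (a.1.coeff g • b.extension.σ g)
      = ∑ g, b.idem * (a.1.coeff g • MonoidAlgebra.of O G g) * b.idem := by
        refine Finset.sum_congr rfl fun g _ => ?_
        rw [map_smul, mul_smul_comm, smul_mul_assoc]
        rfl
    _ = a.1 := by
        rw [← Finset.sum_mul, ← Finset.mul_sum, sum_coeff_smul_of, corner_mul_left,
          corner_mul_right]

theorem finite_fixed [IsNoetherianRing O] [Finite G] (P : Subgroup G) :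
    Module.Finite O (b.extension.fixed P) := by
  have : Module.Finite O b.A :=
    Module.Finite.of_surjective (cornerProj O b.isIdempotentElem_idem) fun c =>
      ⟨c.1, Subtype.ext (by
        change b.idem * c.1 * b.idem = c.1
        rw [corner_mul_left, corner_mul_right])⟩
  exact Module.Finite.of_injective (b.extension.fixed P).val.toLinearMap Subtype.val_injective

variable {P : Subgroup G} {i : b.extension.fixed P} (hi : IsIdempotentElem (i : b.A))

/-- The map `u ↦ ui` on a `p`-group `P` is injective, for any nonzero idempotent `i`. -/
theorem cornerMap_injective [IsLocalRing O] [IsNoetherianRing O] [Finite G] {p : ℕ}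
    [Fact p.Prime] [CharP (IsLocalRing.ResidueField O) p] (hP : IsPGroup p P)
    (h0 : (i : b.A) ≠ 0) : Function.Injective (b.extension.cornerMap i hi) := by
  rw [injective_iff_map_eq_one]
  intro u hu
  by_contra hu1
  have h1 : (b.extension.cornerMap i hi u).1.1 = i :=
    congrArg (fun c : (hi.Corner)ˣ => c.1.1) hu
  have h2 := h1
  rw [InteriorAlgebra.coe_cornerMap_eq_mul] at h1
  rw [InteriorAlgebra.coe_cornerMap_eq_mul'] at h2
  refine h0 (Subtype.ext
    (eq_zero_of_of_mul_eq (u := (u : G)) (congrArg Subtype.val hi.eq) ?_ ?_ ?_))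
  · rw [← coe_mul_σ, h1]
  · rw [← coe_σ_mul, h2]
  -- The order of `u ≠ 1` is a positive power of `p`, hence zero in the residue field.
  · obtain ⟨k, hk⟩ := (IsPGroup.iff_orderOf.1 hP) u
    rw [Subgroup.orderOf_coe, hk, ← IsLocalRing.residue_eq_zero_iff]
    have hk0 : k ≠ 0 := by
      rintro rfl
      exact hu1 (orderOf_eq_one_iff.1 (by simpa using hk))
    simp [hk0]

/-- The fusion of `P` given by `n ∈ N_{hU(iAi)}(Pi)` is the conjugation by some `x ∈ G` of the same
degree as `n`, if `i` is not in the kernel of the Brauer homomorphism. -/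
theorem exists_conj_of_hUNormalizer [IsLocalRing O] [Finite G]
    (hib : (i : b.A) ∉ b.extension.brauerKernel P) {n : (hi.Corner)ˣ} {φ : MulAut P} {y : G ⧸ H}
    (hn : n.1.1 ∈ b.extension.comp y)
    (hφ : ∀ u, b.extension.cornerMap i hi (φ u) = n * b.extension.cornerMap i hi u * n⁻¹) :
    ∃ x : G, (x : G ⧸ H) = y ∧ ∀ u : P, (φ u : G) * x = x * u := by
  have := Fintype.ofFinite G
  by_contra! hcon
  have hu1 (u : P) : b.extension.σ u * n.1.1 = n.1.1 * b.extension.σ (φ⁻¹ u : P) :=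
    InteriorAlgebra.σ_mul_coe_unit hi (by
      have := hφ (φ⁻¹ u)
      rw [MulAut.apply_inv_self] at this
      rw [this]; group)
  have hu2 (u : P) : b.extension.σ (φ⁻¹ u : P) * n⁻¹.1.1 = n⁻¹.1.1 * b.extension.σ u :=
    InteriorAlgebra.σ_mul_coe_unit hi (by
      have := hφ (φ⁻¹ u)
      rw [MulAut.apply_inv_self] at this
      rw [this]; group)
  -- Compare the coefficients at `ux` in `u n = n φ⁻¹(u)`.
  have hcoeff (u : P) (x : G) :
      n.1.1.1.coeff (u * x * ((φ⁻¹ u : P) : G)⁻¹) = n.1.1.1.coeff x := by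
    have h := congrArg (fun a : b.A => a.1.coeff ((u : G) * x)) (hu1 u)
    rw [coe_σ_mul, coe_mul_σ] at h
    simpa using h.symm
  have hninv : n⁻¹.1.1 ∈ b.extension.comp y⁻¹ :=
    (b.extension.cornerGrading i hi).inv_mem n
      (show n.1 ∈ (b.extension.cornerGrading i hi).comp _ from hn)
  have hsum : ∑ x, n.1.1.1.coeff x • (b.extension.σ x * n⁻¹.1.1) = i := by
    have hnn : n.1.1 * n⁻¹.1.1 = i := congrArg Subtype.val n.mul_inv
    refine Eq.trans ?_ hnn
    conv_rhs => rw [← b.sum_coeff_smul_σ n.1.1, Finset.sum_mul]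
    simp only [smul_mul_assoc]
  refine hib (hsum ▸ ?_)
  -- The action of `P` on `G` is passed explicitly, since the twisted one is meant rather than left
  -- multiplication.
  refine @InteriorAlgebra.sum_mem_brauerKernel _ _ _ _ _ _ _ _ _ _ _ _ _ _ _ (twistedAction φ)
    _ (fun u x => ?_) (fun x hx => ?_)
  · change n.1.1.1.coeff (u * x * ((φ⁻¹ u : P) : G)⁻¹) •
      (b.extension.σ (u * x * ((φ⁻¹ u : P) : G)⁻¹) * n⁻¹.1.1) =
      b.extension.σ u * (n.1.1.1.coeff x • (b.extension.σ x * n⁻¹.1.1)) * b.extension.σ (u : G)⁻¹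
    have h := hu2 u⁻¹
    rw [map_inv, Subgroup.coe_inv, Subgroup.coe_inv] at h
    rw [hcoeff, mul_smul_comm, smul_mul_assoc, map_mul, map_mul, mul_assoc _ _ n⁻¹.1.1, h]
    simp only [mul_assoc]
  · have hx0 : n.1.1.1.coeff x ≠ 0 := fun h => hx (by rw [h, zero_smul])
    have hxy : (x : G ⧸ H) = y := by
      by_contra hne
      exact hx0 (hn x hne)
    -- Only `x` in the coset `y` contribute, so each term has degree `y y⁻¹ = 1`. A point fixed by
    -- all of `P` would satisfy `φ(u) x = x u`, which is excluded.
    refine ⟨Submodule.smul_mem _ _ ?_, fun htop => ?_⟩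
    · have := b.extension.mul_mem (b.extension.σ_mem x) hninv
      rwa [hxy, mul_inv_cancel] at this
    · obtain ⟨u, hu⟩ := hcon x hxy
      refine hu ?_
      have hmem : φ u ∈ @MulAction.stabilizer P G _ (twistedAction φ) x := htop ▸ trivial
      have h : (φ u : G) * x * ((φ⁻¹ (φ u) : P) : G)⁻¹ = x := hmem
      rw [MulAut.inv_apply_self] at h
      exact mul_inv_eq_iff_eq_mul.1 h

end InvariantBlock

end GradedFusion

end

/-! ### Assembly for the block extension. -/

open GradedFusion in
theorem mainTheorem3 {O G : Type*} [CommRing O] [IsDomain O] [IsDiscreteValuationRing O]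
    [IsAdicComplete (IsLocalRing.maximalIdeal O) O]
    (p : ℕ) [Fact p.Prime] [CharP (IsLocalRing.ResidueField O) p]
    [Group G] [Finite G] (H : Subgroup G) [H.Normal] (b : InvariantBlock O H)
    (P : Subgroup G) (hP : IsPGroup p P)
    (γ : Set (b.extension.fixed P)) (hγ : b.extension.IsLocalPoint P γ)
    (i : b.extension.fixed P) (hi : i ∈ γ) :
    ∃ (e₁ : b.extension.E P γ ≃* b.extension.NmodC i (hγ.1.isIdempotentElem hi))
      (e₂ : b.extension.NmodC i (hγ.1.isIdempotentElem hi) ≃* b.extension.F i),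
      -- `e₁` maps the class of `g` to the class of `i a⁻¹ g`, if `ᵍi = ᵃi` with `a ∈ (B^P)ˣ`
      (∀ (g : b.extension.pointNormalizer P γ) (a : (b.extension.fixed P)ˣ),
        b.extension.conj g (i : b.A) =
            ((a : b.extension.fixed P) * i * (a⁻¹ : (b.extension.fixed P)ˣ) :
              b.extension.fixed P) →
          ∃ n : b.extension.hUNormalizer i (hγ.1.isIdempotentElem hi),
            n.1.1.1 = (i : b.A) * ((a⁻¹ : (b.extension.fixed P)ˣ) : b.extension.fixed P) *
              b.extension.σ g ∧
            e₁ (QuotientGroup.mk g) = QuotientGroup.mk n) ∧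
      -- `e₂` maps the class of `n` to the pair of the conjugation by `n` on `P ≃ Pi` and the
      -- degree of `n`
      (∀ n : b.extension.hUNormalizer i (hγ.1.isIdempotentElem hi),
        (∀ u : P, b.extension.cornerMap i (hγ.1.isIdempotentElem hi)
            ((e₂ (QuotientGroup.mk n)).1.1.1 u) =
          n.1 * b.extension.cornerMap i (hγ.1.isIdempotentElem hi) u * n.1⁻¹) ∧
        n.1.1.1 ∈ b.extension.comp (e₂ (QuotientGroup.mk n)).1.1.2) ∧
      -- the composite maps the class of `g` to the pair of the conjugation by `g` on `P` and `gH`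
      (∀ g : b.extension.pointNormalizer P γ,
        (∀ u : P, (((e₂ (e₁ (QuotientGroup.mk g))).1.1.1 u : P) : G) = g * u * (g : G)⁻¹) ∧
        (e₂ (e₁ (QuotientGroup.mk g))).1.1.2 = ((g : G) : G ⧸ H)) := by
  have hidem := hγ.1.isIdempotentElem hi
  have h0 : (i : b.A) ≠ 0 := fun h =>
    (hγ.1.isPrimitiveIdempotent hi).2.1 (Subtype.ext h)
  have hinj := b.cornerMap_injective hidem hP h0
  have : Nontrivial hidem.Corner := ⟨⟨1, 0, fun h => h0 (congrArg Subtype.val h)⟩⟩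
  have := b.finite_fixed P
  -- A fusion is first realized by a homogeneous unit `n`, then by an `x ∈ G` of the same degree,
  -- which lies in `N_G(P_γ)`.
  have hsurj : Function.Surjective (InteriorAlgebra.pointHom hγ.1 hi) := by
    intro α
    obtain ⟨n, rfl⟩ := b.extension.fusionHom_surjective i hidem hinj α
    have hn := b.extension.mem_comp_fusionHom i hidem hinj n
    have hφ := b.extension.cornerMap_fusionHom i hidem hinj n
    obtain ⟨x, hx, hxu⟩ := b.exists_conj_of_hUNormalizer hidem (hγ.notMem_brauerKernel hi) hn hφ
    refine ⟨⟨x, hγ.1.mem_pointNormalizer_of_hUNormalizer hidem hi (by rwa [hx]) hφ hxu⟩,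
      Subtype.ext (Subtype.ext (Prod.ext (MulEquiv.ext fun u => Subtype.ext ?_) hx))⟩
    exact mul_inv_eq_iff_eq_mul.2 (hxu u).symm
  exact InteriorAlgebra.exists_fusion_equivs hγ.1 hi hinj hsurj
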